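/- Let $B$ be a Blaschke product on the unit disc $\mathbb D$, that is $B(z)=\lambda z^p\prod_{j}\frac{|a_j|}{a_j}\frac{a_j-z}{1-\overline{a_j}z}$ with $|\lambda|=1$, $p\ge 0$, $0<|a_j|<1$ and $\sum_j(1-|a_j|)<\infty$. A point of the unit circle $\mathbb T$ is regular if $B$ extends analytically to a neighbourhood of it, and is a singularity otherwise. Suppose that $B$ has exactly $n\ge 1$ singularities on $\mathbb T$. Let $I_j$, with $j\in\mathbb Z_n$, be the $n$ complementary open arcs, numbered counterclockwise. Let $\mathcal G$ be the set of continuous maps $x:\mathbb T\to\mathbb T$ that map singularities to singularities and regular points to regular points and satisfy $B\circ x=B$ at all regular points, with composition as its operation. An arc, traversed counterclockwise, is of type $0$ if it contains only finitely many solutions of $B=1$. If it contains infinitely many, it is of type $1_a$, $1_b$ or $2$ according as they accumulate precisely at its initial endpoint, precisely at its final endpoint, or precisely at both (for $n=1$ the two ends of the single arc are distinguished). Two arcs have the same type if - both are of type $2$; or - both are of type $1_a$ and the one-sided limits of $B$ at their final endpoints, taken along the arcs, are equal; or - both are of type $1_b$ and the one-sided limits of $B$ at their initial endpoints, taken along the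 arcs, are equal; or - both are of type $0$ and their images under $B$ agree with multiplicities, i.e. $B$ takes every value equally often on both. Let $k$ be the number of arcs of type $2$, and let $d$ be the number of $r\in\mathbb Z_n$ such that $I_j$ and $I_{j+r}$ have the same type for every $j$. **Theorem.** We have $0\le k\le n$, $1\le d\le n$ and $d\mid n$, and $\mathcal G$ is a group with $\mathcal G\cong\mathbb Z^k\rtimes\mathbb Z_d$. More precisely, there are elements $x_j\in\mathcal G$, one for each $j$ such that $I_j$ is of type $2$, and $y\in\mathcal G$ such that - $x_j$ maps each point of $I_j$ to the next point of $I_j$, in the order of increasing argument, at which $B$ takes the same value, and $x_j$ fixes all points outside $I_j$; - $y(I_j)=I_{j+n/d}$ for all $j\in\mathbb Z_n$; - $\mathcal G=\langle x_j,\,y:\ y^d=e,\ x_jx_l=x_lx_j,\ y x_j=x_{j+n/d}\,y\rangle$, where $j,l$ run over the indices of the arcs of type $2$ and indices are taken modulo $n$. Moreover, there is an isomorphism $\mathcal G\cong\mathbb Z^k\rtimes\mathbb Z_d$ under which the $x_j$ correspond to the standard basis of $\mathbb Z^k$ and $y$ to the generator $1$ of $\mathbb Z_d$. -/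

import Mathlib

open Set Filter Topology

noncomputable section

namespace BlaschkeInvariants

/-- The elementary factor `(|a| / a) * (a - z) / (1 - conj a * z)`. -/
def blaschkeFactor (a z : ℂ) : ℂ :=
  ((‖a‖ : ℂ) / a) * ((a - z) / (1 - (starRingEnd ℂ) a * z))

/-- `B` is, on the open unit disc, a (finite or infinite) Blaschke product
`λ z ^ p ∏ (|a_j| / a_j) (a_j - z) / (1 - conj a_j z)` with `|λ| = 1`, `0 < |a_j| < 1` and
`∑ (1 - |a_j|) < ∞`. Only the values of `B` on the open disc matter. -/
def IsBlaschkeProduct (B : ℂ → ℂ) : Prop :=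
  ∃ (c : Circle) (p : ℕ) (ι : Type) (a : ι → ℂ),
    (∀ j, a j ≠ 0 ∧ ‖a j‖ < 1) ∧ Summable (fun j => 1 - ‖a j‖) ∧
    ∀ z ∈ Metric.ball (0 : ℂ) 1, B z = c * z ^ p * ∏' j, blaschkeFactor (a j) z

/-- `B` (defined on the open disc) extends analytically to a neighbourhood of the point `p` of the
unit circle. -/
def IsRegularPoint (B : ℂ → ℂ) (p : Circle) : Prop :=
  ∃ g : ℂ → ℂ, AnalyticAt ℂ g (p : ℂ) ∧
    ∀ᶠ z in 𝓝[Metric.ball (0 : ℂ) 1] (p : ℂ), g z = B z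

/-- The spectrum: the set of singularities of `B` on the unit circle. -/
def singularSet (B : ℂ → ℂ) : Set Circle := {p | ¬ IsRegularPoint B p}

/-- The boundary value of `B` at a point of the circle, i.e. the limit of `B` from inside the disc.
It is only used at regular points, where it is the value of the analytic extension. -/
def boundaryValue (B : ℂ → ℂ) (p : Circle) : ℂ :=
  extendFrom (Metric.ball (0 : ℂ) 1) B (p : ℂ)

/-- The continuous invariants of `B`: continuous `x : 𝕋 → 𝕋` that map singular points to singular
points and regular points to regular points, with `B ∘ x = B` at the regular points.
The operation is composition; that all elements are invertible is not part of the definition. -/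
def invariants (B : ℂ → ℂ) : Submonoid (Function.End Circle) where
  carrier := {x | Continuous (x : Circle → Circle) ∧
    (∀ p, p ∈ singularSet B → x p ∈ singularSet B) ∧
    (∀ p, p ∉ singularSet B → x p ∉ singularSet B) ∧
    (∀ p, p ∉ singularSet B → boundaryValue B (x p) = boundaryValue B p)}
  one_mem' := ⟨continuous_id, fun _ h => h, fun _ h => h, fun _ _ => rfl⟩
  mul_mem' := by
    rintro x y ⟨hx, hxs, hxr, hxB⟩ ⟨hy, hys, hyr, hyB⟩
    exact ⟨hx.comp hy, fun p hp => hxs _ (hys p hp), fun p hp => hxr _ (hyr p hp),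
      fun p hp => (hxB _ (hyr p hp)).trans (hyB p hp)⟩

/-- `θ` lists, counterclockwise and lifted to the real line with period `n`, the arguments of the
points of `S`: `θ j < θ (j + 1)`, `θ (j + n) = θ j + 2π` and `S = {exp (i θ j)}`. -/
structure IsCyclicEnumeration (S : Set Circle) (n : ℕ) (θ : ℤ → ℝ) : Prop where
  strictMono : StrictMono θ
  add_period : ∀ j, θ (j + n) = θ j + 2 * Real.pi
  range_eq : Set.range (fun j => Circle.exp (θ j)) = S

/-- Every set of exactly `n ≥ 1` points of the circle has such an enumeration. -/
theorem exists_isCyclicEnumeration (S : Set Circle) (n : ℕ) (hn : 0 < n) (hS : S.encard = n) :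
    ∃ θ, IsCyclicEnumeration S n θ := by
  have hpi := Real.pi_pos
  have hinj : InjOn (fun t : ℝ => Circle.exp t) (Ico 0 (2 * Real.pi)) := by
    intro s hs t ht hst
    obtain ⟨m, hm⟩ := Circle.exp_eq_exp.1 hst
    have h1 : (m : ℝ) < 1 := by
      by_contra h
      nlinarith [hs.1, hs.2, ht.1, ht.2]
    have h2 : (-1 : ℝ) < m := by
      by_contra h
      nlinarith [hs.1, hs.2, ht.1, ht.2]
    have h3 : m < 1 := by exact_mod_cast h1
    have h4 : -1 < m := by exact_mod_cast h2
    have : m = 0 := by omega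
    subst this
    simpa using hm
  have hsurj : ∀ p : Circle, ∃ t ∈ Ico 0 (2 * Real.pi), Circle.exp t = p := by
    intro p
    refine ⟨toIcoMod Real.two_pi_pos 0 (Complex.arg p), ?_, ?_⟩
    · simpa using toIcoMod_mem_Ico Real.two_pi_pos 0 (Complex.arg p)
    · rw [toIcoMod, ← Circle.exp_arg p, Circle.exp_eq_exp]
      refine ⟨-toIcoDiv Real.two_pi_pos 0 (Complex.arg p), ?_⟩
      simp only [Circle.exp_arg, zsmul_eq_mul]
      push_cast
      ring
  set T : Set ℝ := {t ∈ Ico 0 (2 * Real.pi) | Circle.exp t ∈ S} with hT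
  have hTS : (fun t : ℝ => Circle.exp t) '' T = S := by
    ext p
    constructor
    · rintro ⟨t, ht, rfl⟩
      exact ht.2
    · intro hp
      obtain ⟨t, ht, rfl⟩ := hsurj p
      exact ⟨t, ⟨ht, hp⟩, rfl⟩
  have hTc : T.encard = n := by
    rw [← hS, ← hTS]
    exact ((hinj.mono fun t ht => ht.1).encard_image).symm
  have hTf : T.Finite := Set.finite_of_encard_eq_coe hTc
  have hcard : hTf.toFinset.card = n := by
    have := hTf.encard_eq_coe_toFinset_card
    rw [hTc] at this
    exact_mod_cast this.symm
  set e := hTf.toFinset.orderEmbOfFin hcard with he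
  have heT : ∀ i, e i ∈ T := fun i =>
    hTf.mem_toFinset.1 (hTf.toFinset.orderEmbOfFin_mem hcard i)
  have hn' : (0 : ℤ) < n := by exact_mod_cast hn
  let idx : ℤ → Fin n := fun j => ⟨(j % n).toNat, by
    have := Int.emod_lt_of_pos j hn'
    have := Int.emod_nonneg j hn'.ne'
    omega⟩
  refine ⟨fun j => e (idx j) + 2 * Real.pi * ((j / n : ℤ) : ℝ), ?_, ?_, ?_⟩
  · intro i j hij
    have hi := (heT (idx i)).1
    have hj := (heT (idx j)).1
    rcases (Int.ediv_le_ediv hn' hij.le).lt_or_eq with h | h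
    · have h' : ((i / n : ℤ) : ℝ) + 1 ≤ ((j / n : ℤ) : ℝ) := by exact_mod_cast h
      have := hi.2
      have := hj.1
      simp only
      nlinarith
    · have hlt : idx i < idx j := by
        rw [Fin.lt_def]
        have h1 := Int.emod_add_mul_ediv i n
        have h2 := Int.emod_add_mul_ediv j n
        have := Int.emod_nonneg i hn'.ne'
        have := Int.emod_nonneg j hn'.ne'
        rw [h] at h1
        simp only [idx]
        omega
      have := e.strictMono hlt
      simp only [h]
      linarith
  · intro j
    have h1 : idx (j + n) = idx j := by simp [idx]
    have h2 : (j + n) / (n : ℤ) = j / n + 1 := by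
      rw [Int.add_ediv_of_dvd_right (dvd_refl _), Int.ediv_self hn'.ne']
    simp only [h1, h2]
    push_cast
    ring
  · have hexp : ∀ j, Circle.exp (e (idx j) + 2 * Real.pi * ((j / n : ℤ) : ℝ))
        = Circle.exp (e (idx j)) := by
      intro j
      rw [Circle.exp_eq_exp]
      exact ⟨j / n, by ring⟩
    ext p
    constructor
    · rintro ⟨j, rfl⟩
      simp only [hexp]
      exact (heT _).2
    · intro hp
      rw [← hTS] at hp
      obtain ⟨t, ht, rfl⟩ := hp
      have : t ∈ Set.range e := by
        rw [he, Finset.range_orderEmbOfFin]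
        simpa using ht
      obtain ⟨i, rfl⟩ := this
      refine ⟨(i : ℕ), ?_⟩
      simp only [hexp]
      congr 2
      ext
      have : ((i : ℕ) : ℤ) % n = (i : ℕ) :=
        Int.emod_eq_of_lt (by omega) (by exact_mod_cast i.2)
      simp [idx, this]

/-- The open arc `{exp (i t) : α < t < β}`. -/
def arcSet (α β : ℝ) : Set Circle := Circle.exp '' Ioo α β

/-- The arguments in `(α, β)` of the solutions of `B = w` on the arc. -/
def solutions (B : ℂ → ℂ) (w : ℂ) (α β : ℝ) : Set ℝ :=
  {t ∈ Ioo α β | boundaryValue B (Circle.exp t) = w}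

/-- Type `0`: finitely many solutions of `B = 1`. -/
def IsType0 (B : ℂ → ℂ) (α β : ℝ) : Prop := (solutions B 1 α β).Finite

/-- Type `1_a`: infinitely many solutions of `B = 1`, accumulating precisely at the initial
endpoint. -/
def IsType1a (B : ℂ → ℂ) (α β : ℝ) : Prop :=
  (solutions B 1 α β).Infinite ∧ {t | AccPt t (𝓟 (solutions B 1 α β))} = {α}

/-- Type `1_b`: infinitely many solutions of `B = 1`, accumulating precisely at the final
endpoint. -/
def IsType1b (B : ℂ → ℂ) (α β : ℝ) : Prop :=
  (solutions B 1 α β).Infinite ∧ {t | AccPt t (𝓟 (solutions B 1 α β))} = {β}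

/-- Type `2`: infinitely many solutions of `B = 1`, accumulating precisely at both endpoints. -/
def IsType2 (B : ℂ → ℂ) (α β : ℝ) : Prop :=
  (solutions B 1 α β).Infinite ∧ {t | AccPt t (𝓟 (solutions B 1 α β))} = {α, β}

/-- The arcs `(α, β)` and `(α', β')` have exactly the same type. For type `1_a` and `1_b` this
includes equality of the one-sided limits of `B` at the endpoint where the solutions do not
accumulate; for type `0` it means that the images under `B` agree with multiplicities. -/
def SameType (B : ℂ → ℂ) (α β α' β' : ℝ) : Prop :=
  (IsType0 B α β ∧ IsType0 B α' β' ∧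
    ∀ w : ℂ, (solutions B w α β).encard = (solutions B w α' β').encard) ∨
  (IsType1a B α β ∧ IsType1a B α' β' ∧
    ∃ L : ℂ, Tendsto (fun t => boundaryValue B (Circle.exp t)) (𝓝[<] β) (𝓝 L) ∧
      Tendsto (fun t => boundaryValue B (Circle.exp t)) (𝓝[<] β') (𝓝 L)) ∨
  (IsType1b B α β ∧ IsType1b B α' β' ∧
    ∃ L : ℂ, Tendsto (fun t => boundaryValue B (Circle.exp t)) (𝓝[>] α) (𝓝 L) ∧
      Tendsto (fun t => boundaryValue B (Circle.exp t)) (𝓝[>] α') (𝓝 L)) ∨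
  (IsType2 B α β ∧ IsType2 B α' β')

/-- Argument of the initial point of the arc `I_j`, where `j` is taken modulo `n`. -/
def arcStart {n : ℕ} (θ : ℤ → ℝ) (j : ZMod n) : ℝ := θ (j.val : ℤ)

/-- Argument of the final point of the arc `I_j`. -/
def arcEnd {n : ℕ} (θ : ℤ → ℝ) (j : ZMod n) : ℝ := θ ((j.val : ℤ) + 1)

/-- The arc `I_j` of the circle. -/
def arc {n : ℕ} (θ : ℤ → ℝ) (j : ZMod n) : Set Circle := arcSet (arcStart θ j) (arcEnd θ j)

/-- The indices `j` modulo `n` for which `I_j` is of type `2`. -/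
def type2Indices (B : ℂ → ℂ) (n : ℕ) (θ : ℤ → ℝ) : Set (ZMod n) :=
  {j | IsType2 B (arcStart θ j) (arcEnd θ j)}

/-- The cyclic permutations `I_j ↦ I_(j + r)` of the `n` arcs that map each arc onto one of the
same type. -/
def typePreservingRotations (B : ℂ → ℂ) (n : ℕ) (θ : ℤ → ℝ) : Set (ZMod n) :=
  {r | ∀ j : ZMod n,
    SameType B (arcStart θ j) (arcEnd θ j) (arcStart θ (j + r)) (arcEnd θ (j + r))}

/-- `x` shifts the elements of the arc `(α, β)`: it sends each point of the arc to the next one,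
in the order of increasing argument, at which `B` takes the same value. -/
def ShiftsElements (B : ℂ → ℂ) (x : Circle → Circle) (α β : ℝ) : Prop :=
  ∀ t ∈ Ioo α β, ∃ s ∈ Ioo t β, x (Circle.exp t) = Circle.exp s ∧
    boundaryValue B (Circle.exp s) = boundaryValue B (Circle.exp t) ∧
    ∀ u ∈ Ioo t s, boundaryValue B (Circle.exp u) ≠ boundaryValue B (Circle.exp t)

/-- The relations `y ^ d = e`, `x_j x_l = x_l x_j`, `y x_j = x_(j + n/d) y` on generators `x_j`
(`j ∈ J`, written `some j`) and `y` (written `none`); indices are modulo `n`. -/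
def relations (n d : ℕ) (J : Set (ZMod n)) : Set (FreeGroup (Option J)) :=
  {FreeGroup.of none ^ d} ∪
  {w | ∃ j l : J, w = FreeGroup.of (some j) * FreeGroup.of (some l) *
    (FreeGroup.of (some l) * FreeGroup.of (some j))⁻¹} ∪
  {w | ∃ j l : J, (l : ZMod n) = (j : ZMod n) + ((n / d : ℕ) : ZMod n) ∧
    w = FreeGroup.of none * FreeGroup.of (some j) *
      (FreeGroup.of (some l) * FreeGroup.of none)⁻¹}

end BlaschkeInvariants

end

open BlaschkeInvariants

open Set Filter Topology

noncomputable section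

open ComplexConjugate

namespace BlaschkeInvariants

/-! On a complementary arc the boundary values of $B$ are unimodular and turn strictly
counterclockwise, so $B=e^{iH}$ there with $H$ continuous and strictly increasing
(`IsBlaschkeProduct.exists_strictMonoOn_lift`). This identifies the arc $I_j$ with an open interval
$D_j=H(I_j)$ on which $B$ becomes $u\mapsto e^{iu}$. The solutions of $B=1$ are the multiples of
$2\pi$ in $D_j$. They accumulate at an end of the arc exactly when $D_j$ is unbounded on that side,
and two arcs have the same type exactly when their intervals differ by a translation in $2\pi\mathbb
Z$. After normalising $H$ on each arc, same type means $D_i=D_j$ (`IsPeriodicArg.sameType_iff`).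

Lift an invariant to a continuous $X:\mathbb R\to\mathbb R$. By connectedness it sends an arc into a
single arc, and $H\circ X-H$ is constant there, being continuous with values in $2\pi\mathbb Z$.
Hence $X$ increases on arcs, takes consecutive endpoints to consecutive endpoints, and so rotates
the arcs by some $s$ while translating $D_j$ onto $D_{j+s}$ by $2\pi c_{j+s}$. By the normalisation,
$c_{j+s}=0$ unless the interval is all of $\mathbb R$, that is, unless the arc is of type $2$
(`exists_isInducedBy_of_mem_invariants`). Conversely, every such pair $(s,c)$ comes from exactly one
invariant (`IsAdmissible.exists_isInducedBy`, `IsInducedBy.eq`), and distinct pairs give distinct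
invariants (`IsInducedBy.injective`).

Pairs compose by $(s,c)(s',c')=(s+s',\,c+c'(\cdot-s))$. This is the law of $\mathbb
Z^k\rtimes\mathbb Z_d$, where $\mathbb Z_d$ is the group of type-preserving rotations, generated by
$n/d$ (`exists_mulEquiv_invariants`). The presentation is then pure algebra
(`exists_presentedGroup_mulEquiv`). -/

/-! ### Estimates for a single Blaschke factor. -/

lemma sq_norm_one_sub_conj_mul_sub (a z : ℂ) :
    ‖1 - conj a * z‖ ^ 2 - ‖a - z‖ ^ 2 = (1 - ‖a‖ ^ 2) * (1 - ‖z‖ ^ 2) := by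
  simp only [Complex.sq_norm, Complex.normSq_apply, Complex.sub_re, Complex.sub_im,
    Complex.one_re, Complex.one_im, Complex.mul_re, Complex.mul_im, Complex.conj_re,
    Complex.conj_im]
  ring

lemma norm_sub_le_norm_one_sub_conj_mul {a z : ℂ} (ha : ‖a‖ ≤ 1) (hz : ‖z‖ ≤ 1) :
    ‖a - z‖ ≤ ‖1 - conj a * z‖ := by
  refine le_of_sq_le_sq ?_ (norm_nonneg _)
  have h := sq_norm_one_sub_conj_mul_sub a z
  have h1 : 0 ≤ 1 - ‖a‖ ^ 2 := by nlinarith [norm_nonneg a]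
  have h2 : 0 ≤ 1 - ‖z‖ ^ 2 := by nlinarith [norm_nonneg z]
  nlinarith [mul_nonneg h1 h2]

lemma one_sub_norm_le_norm_one_sub_conj_mul {a : ℂ} (z : ℂ) (ha : ‖a‖ ≤ 1) :
    1 - ‖z‖ ≤ ‖1 - conj a * z‖ := by
  have h := norm_sub_norm_le (1 : ℂ) (conj a * z)
  rw [norm_one, norm_mul, RCLike.norm_conj] at h
  nlinarith [norm_nonneg z]

lemma one_sub_conj_mul_ne_zero {a z : ℂ} (ha : ‖a‖ ≤ 1) (hz : ‖z‖ < 1) :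
    1 - conj a * z ≠ 0 := by
  rw [← norm_pos_iff]
  linarith [one_sub_norm_le_norm_one_sub_conj_mul z ha]

lemma norm_blaschkeFactor {a z : ℂ} (ha : a ≠ 0) :
    ‖blaschkeFactor a z‖ = ‖a - z‖ / ‖1 - conj a * z‖ := by
  have : ‖a‖ ≠ 0 := norm_ne_zero_iff.2 ha
  simp [blaschkeFactor, this]

lemma norm_blaschkeFactor_le_one {a z : ℂ} (ha : a ≠ 0) (ha1 : ‖a‖ ≤ 1) (hz : ‖z‖ ≤ 1) :
    ‖blaschkeFactor a z‖ ≤ 1 := by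
  rw [norm_blaschkeFactor ha]
  exact div_le_one_of_le₀ (norm_sub_le_norm_one_sub_conj_mul ha1 hz) (norm_nonneg _)

/-- The difference equals $(|a|-1)(a+|a|z)/(a(1-\bar az))$, and $|a+|a|z|\le 2|a|$. Leaving `δ` free
serves both for convergence inside the disc, with $\delta=1-|z|$, and for domination near a boundary
point away from the zeros. -/
lemma norm_blaschkeFactor_sub_one_le {a z : ℂ} (ha : a ≠ 0) (ha1 : ‖a‖ ≤ 1) (hz : ‖z‖ ≤ 1)
    {δ : ℝ} (hδ : 0 < δ) (h : δ ≤ ‖1 - conj a * z‖) :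
    ‖blaschkeFactor a z - 1‖ ≤ (1 - ‖a‖) * (2 / δ) := by
  have h0 : 1 - conj a * z ≠ 0 := norm_pos_iff.1 (hδ.trans_le h)
  have hpos : 0 < ‖a‖ := norm_pos_iff.2 ha
  have key : blaschkeFactor a z - 1 =
      ((‖a‖ : ℂ) - 1) * ((a + ‖a‖ * z) / a) / (1 - conj a * z) := by
    rw [blaschkeFactor, eq_div_iff h0, sub_mul, mul_assoc, div_mul_cancel₀ _ h0]
    field_simp
    linear_combination z * Complex.mul_conj' a
  have h1 : ‖(‖a‖ : ℂ) - 1‖ = 1 - ‖a‖ := by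
    rw [norm_sub_rev, ← Complex.ofReal_one, ← Complex.ofReal_sub, Complex.norm_real,
      Real.norm_of_nonneg (by linarith)]
  have h2 : ‖(a + ‖a‖ * z) / a‖ ≤ 2 := by
    rw [norm_div, div_le_iff₀ hpos]
    refine (norm_add_le _ _).trans ?_
    rw [norm_mul, Complex.norm_real, norm_norm]
    nlinarith
  rw [key, norm_div, norm_mul, h1, mul_div_assoc]
  have : 0 ≤ 1 - ‖a‖ := by linarith
  gcongr

/-! ### The infinite product: convergence, bounds and holomorphy. -/

/-- Weierstrass' inequality. It turns a small sum of the defects $1-|b_j|$ into a product of modulus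
close to $1$. -/
lemma one_sub_sum_le_prod {ι : Type*} (s : Finset ι) {f : ι → ℝ} (h0 : ∀ i, 0 ≤ f i)
    (h1 : ∀ i, f i ≤ 1) : 1 - ∑ i ∈ s, (1 - f i) ≤ ∏ i ∈ s, f i := by
  classical
  induction s using Finset.induction_on with
  | empty => simp
  | insert i s hi ih =>
    rw [Finset.sum_insert hi, Finset.prod_insert hi]
    have hs : ∏ j ∈ s, f j ≤ 1 := Finset.prod_le_one (fun j _ => h0 j) (fun j _ => h1 j)
    nlinarith [h0 i, h1 i]

section Product

variable {ι : Type} {a : ι → ℂ} (ha : ∀ j, a j ≠ 0 ∧ ‖a j‖ < 1)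
  (hs : Summable fun j => 1 - ‖a j‖)

include ha hs

lemma summable_norm_blaschkeFactor_sub_one {z : ℂ} (hz : ‖z‖ < 1) :
    Summable fun j => ‖blaschkeFactor (a j) z - 1‖ :=
  Summable.of_nonneg_of_le (fun _ => norm_nonneg _)
    (fun j => norm_blaschkeFactor_sub_one_le (ha j).1 (ha j).2.le hz.le (sub_pos.2 hz)
      (one_sub_norm_le_norm_one_sub_conj_mul z (ha j).2.le)) (hs.mul_right _)

lemma multipliable_blaschkeFactor {z : ℂ} (hz : ‖z‖ < 1) :
    Multipliable fun j => blaschkeFactor (a j) z := by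
  simpa using multipliable_one_add_of_summable (summable_norm_blaschkeFactor_sub_one ha hs hz)

lemma norm_tprod_blaschkeFactor_le_one {z : ℂ} (hz : ‖z‖ < 1) :
    ‖∏' j, blaschkeFactor (a j) z‖ ≤ 1 := by
  refine le_of_tendsto (multipliable_blaschkeFactor ha hs hz).hasProd.norm
    (Eventually.of_forall fun s => ?_)
  exact Finset.prod_le_one (fun _ _ => norm_nonneg _)
    fun j _ => norm_blaschkeFactor_le_one (ha j).1 (ha j).2.le hz.le

lemma summable_one_sub_norm_blaschkeFactor {z : ℂ} (hz : ‖z‖ < 1) :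
    Summable fun j => 1 - ‖blaschkeFactor (a j) z‖ := by
  refine Summable.of_nonneg_of_le (fun j => ?_) (fun j => ?_)
    (summable_norm_blaschkeFactor_sub_one ha hs hz)
  · linarith [norm_blaschkeFactor_le_one (ha j).1 (ha j).2.le hz.le]
  · have := norm_sub_norm_le (1 : ℂ) (blaschkeFactor (a j) z)
    rwa [norm_one, norm_sub_rev] at this

lemma one_sub_tsum_le_norm_tprod_blaschkeFactor {z : ℂ} (hz : ‖z‖ < 1) :
    1 - ∑' j, (1 - ‖blaschkeFactor (a j) z‖) ≤ ‖∏' j, blaschkeFactor (a j) z‖ := by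
  refine le_of_tendsto_of_tendsto'
    (tendsto_const_nhds.sub (summable_one_sub_norm_blaschkeFactor ha hs hz).hasSum)
    (multipliable_blaschkeFactor ha hs hz).hasProd.norm fun s => ?_
  exact one_sub_sum_le_prod s (fun _ => norm_nonneg _)
    fun j => norm_blaschkeFactor_le_one (ha j).1 (ha j).2.le hz.le

lemma differentiableOn_tprod_blaschkeFactor :
    DifferentiableOn ℂ (fun z => ∏' j, blaschkeFactor (a j) z) (Metric.ball 0 1) := by
  have hd : ∀ j, DifferentiableOn ℂ (blaschkeFactor (a j)) (Metric.ball 0 1) := by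
    intro j z hz
    have := one_sub_conj_mul_ne_zero (ha j).2.le (mem_ball_zero_iff.1 hz)
    unfold blaschkeFactor
    exact (by fun_prop (disch := assumption) : DifferentiableAt ℂ _ z).differentiableWithinAt
  intro z hz
  -- The majorant $(1-|a_j|)\cdot 2/(1-r)$ is uniform only on a smaller disc, so each point gets its
  -- own radius.
  obtain ⟨r, hzr, hr1⟩ := exists_between (mem_ball_zero_iff.1 hz)
  have hsub : Metric.ball (0 : ℂ) r ⊆ Metric.ball 0 1 := Metric.ball_subset_ball hr1.le
  have key := Summable.hasProdLocallyUniformlyOn_one_add (K := Metric.ball (0 : ℂ) r)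
    (f := fun j z => blaschkeFactor (a j) z - 1) Metric.isOpen_ball
    (hs.mul_right (2 / (1 - r)))
    (Eventually.of_forall fun j w hw =>
      norm_blaschkeFactor_sub_one_le (ha j).1 (ha j).2.le
        (mem_ball_zero_iff.1 (hsub hw)).le (sub_pos.2 hr1)
        ((sub_le_sub_left (mem_ball_zero_iff.1 hw).le 1).trans
          (one_sub_norm_le_norm_one_sub_conj_mul w (ha j).2.le)))
    fun j => ((hd j).mono hsub).continuousOn.sub continuousOn_const
  simp only [add_sub_cancel] at key
  rw [hasProdLocallyUniformlyOn_iff_tendstoLocallyUniformlyOn] at key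
  have hdiff := key.differentiableOn (Eventually.of_forall fun s =>
    DifferentiableOn.fun_finsetProd fun j _ => (hd j).mono hsub) Metric.isOpen_ball
  exact (hdiff.differentiableAt
    (Metric.isOpen_ball.mem_nhds (mem_ball_zero_iff.2 hzr))).differentiableWithinAt

end Product

lemma IsBlaschkeProduct.differentiableOn {B : ℂ → ℂ} (hB : IsBlaschkeProduct B) :
    DifferentiableOn ℂ B (Metric.ball 0 1) := by
  obtain ⟨c, p, ι, a, ha, hs, hB⟩ := hB
  refine DifferentiableOn.congr ?_ hB
  exact ((differentiableOn_const _).mul (differentiableOn_id.pow p)).mul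
    (differentiableOn_tprod_blaschkeFactor ha hs)

lemma IsBlaschkeProduct.norm_le_one {B : ℂ → ℂ} (hB : IsBlaschkeProduct B) {z : ℂ}
    (hz : z ∈ Metric.ball (0 : ℂ) 1) : ‖B z‖ ≤ 1 := by
  obtain ⟨c, p, ι, a, ha, hs, hB⟩ := hB
  have hz' := mem_ball_zero_iff.1 hz
  rw [hB z hz, norm_mul, norm_mul, Circle.norm_coe, one_mul, norm_pow]
  exact mul_le_one₀ (pow_le_one₀ (norm_nonneg _) hz'.le) (norm_nonneg _)
    (norm_tprod_blaschkeFactor_le_one ha hs hz')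

/-! ### Boundary values at regular points. -/

lemma nhdsWithin_ball_circle_neBot (p : Circle) :
    (𝓝[Metric.ball (0 : ℂ) 1] (p : ℂ)).NeBot := by
  rw [← mem_closure_iff_nhdsWithin_neBot, closure_ball _ one_ne_zero]
  simp [Circle.norm_coe]

lemma boundaryValue_eq_of_analyticAt {B g : ℂ → ℂ} {p : Circle} (hg : AnalyticAt ℂ g p)
    (h : ∀ᶠ z in 𝓝[Metric.ball (0 : ℂ) 1] (p : ℂ), g z = B z) :
    boundaryValue B p = g p := by
  have := nhdsWithin_ball_circle_neBot p
  refine extendFrom_eq (mem_closure_iff_nhdsWithin_neBot.2 this) ?_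
  exact (hg.continuousAt.mono_left nhdsWithin_le_nhds).congr' h

/-- The analytic extension at a regular point is the boundary value at all nearby points, which
are regular as well. -/
lemma eventually_boundaryValue_eq {B g : ℂ → ℂ} {p : Circle} (hg : AnalyticAt ℂ g p)
    (h : ∀ᶠ z in 𝓝[Metric.ball (0 : ℂ) 1] (p : ℂ), g z = B z) :
    ∀ᶠ q : Circle in 𝓝 p, IsRegularPoint B q ∧ boundaryValue B q = g q := by
  have h1 : ∀ᶠ w in 𝓝 (p : ℂ), AnalyticAt ℂ g w := hg.eventually_analyticAt
  have h2 : ∀ᶠ w in 𝓝 (p : ℂ), ∀ᶠ z in 𝓝[Metric.ball (0 : ℂ) 1] w, g z = B z := by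
    filter_upwards [eventually_eventually_nhds.2 (eventually_nhdsWithin_iff.1 h)] with w hw
    exact eventually_nhdsWithin_iff.2 hw
  have hc : Tendsto (fun q : Circle => (q : ℂ)) (𝓝 p) (𝓝 p) :=
    (by fun_prop : Continuous fun q : Circle => (q : ℂ)).continuousAt
  filter_upwards [hc.eventually h1, hc.eventually h2] with q hq1 hq2
  exact ⟨⟨g, hq1, hq2⟩, boundaryValue_eq_of_analyticAt hq1 hq2⟩

/-- By the identity theorem $B$ would be constant on the disc, and then every point of the circle
would be regular. The existence of a singularity is thus what excludes constant $B$. -/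
lemma IsBlaschkeProduct.not_eventually_const {B g : ℂ → ℂ} (hB : IsBlaschkeProduct B)
    (hne : (singularSet B).Nonempty) {p : Circle} (c : ℂ)
    (h : ∀ᶠ z in 𝓝[Metric.ball (0 : ℂ) 1] (p : ℂ), g z = B z) :
    ¬ ∀ᶠ z in 𝓝 (p : ℂ), g z = c := by
  intro hc
  have hnb := nhdsWithin_ball_circle_neBot p
  have h1 : ∀ᶠ z in 𝓝[Metric.ball (0 : ℂ) 1] (p : ℂ), ∀ᶠ w in 𝓝 z, B w = c := by
    have : ∀ᶠ z in 𝓝[Metric.ball (0 : ℂ) 1] (p : ℂ), B z = c := by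
      filter_upwards [h, hc.filter_mono nhdsWithin_le_nhds] with z hz hz'
      rw [← hz, hz']
    filter_upwards [eventually_eventually_nhdsWithin.2 this, self_mem_nhdsWithin] with z hz hzb
    rwa [Metric.isOpen_ball.nhdsWithin_eq hzb] at hz
  obtain ⟨z₀, hz₀, hz₀b⟩ := (h1.and self_mem_nhdsWithin).exists
  have hEq : EqOn B (fun _ => c) (Metric.ball 0 1) :=
    (hB.differentiableOn.analyticOnNhd Metric.isOpen_ball).eqOn_of_preconnected_of_eventuallyEq
      (fun _ _ => analyticAt_const) (convex_ball _ _).isPreconnected hz₀b hz₀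
  obtain ⟨q, hq⟩ := hne
  exact hq ⟨fun _ => c, analyticAt_const,
    eventually_nhdsWithin_of_forall fun z hz => (hEq hz).symm⟩

/-- The extension is not locally zero, so the zeros keep a distance `ε` from `p`. Near `p` the
defects $1-|b_j(z)|$ are then dominated by a summable family and each tends to $0$; so does their
sum, and $|B|$ is squeezed between $|z|^m(1-\sum_j(1-|b_j(z)|))$ and $1$. -/
lemma IsBlaschkeProduct.norm_boundaryValue {B : ℂ → ℂ} (hB : IsBlaschkeProduct B)
    (hne : (singularSet B).Nonempty) {p : Circle} (hp : p ∉ singularSet B) :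
    ‖boundaryValue B p‖ = 1 := by
  obtain ⟨g, hg, h⟩ := not_not.1 hp
  have hnb := nhdsWithin_ball_circle_neBot p
  rw [boundaryValue_eq_of_analyticAt hg h]
  have hlim : Tendsto (fun z => ‖B z‖) (𝓝[Metric.ball (0 : ℂ) 1] (p : ℂ)) (𝓝 ‖g p‖) :=
    (((hg.continuousAt.mono_left nhdsWithin_le_nhds).congr' h)).norm
  refine tendsto_nhds_unique hlim ?_
  have hB' := hB
  have hnz : ∀ᶠ z in 𝓝[Metric.ball (0 : ℂ) 1] (p : ℂ), B z ≠ 0 := by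
    have h0 := hg.eventually_eq_zero_or_eventually_ne_zero.resolve_left
      (hB.not_eventually_const hne 0 h)
    have hsub : Metric.ball (0 : ℂ) 1 ⊆ {(p : ℂ)}ᶜ := by
      rintro z hz rfl
      simp [Circle.norm_coe] at hz
    filter_upwards [h0.filter_mono (nhdsWithin_mono _ hsub), h] with z hz hz'
    rwa [← hz']
  obtain ⟨ε, hε, hnz⟩ := Metric.eventually_nhds_iff.1 (eventually_nhdsWithin_iff.1 hnz)
  obtain ⟨c, m, ι, a, ha, hs, hBeq⟩ := hB
  have hfar : ∀ j, ε ≤ ‖a j - p‖ := by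
    intro j
    by_contra! hlt
    have hb : a j ∈ Metric.ball (0 : ℂ) 1 := mem_ball_zero_iff.2 (ha j).2
    refine hnz (by rwa [dist_eq_norm]) hb ?_
    rw [hBeq _ hb, tprod_of_exists_eq_zero ⟨j, by simp [blaschkeFactor]⟩, mul_zero]
  have hnear : ∀ᶠ z in 𝓝[Metric.ball (0 : ℂ) 1] (p : ℂ), ‖z - (p : ℂ)‖ < ε / 2 := by
    refine Eventually.filter_mono nhdsWithin_le_nhds ?_
    filter_upwards [Metric.ball_mem_nhds (p : ℂ) (half_pos hε)] with z hz
    rwa [← dist_eq_norm]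
  have hsum : Tendsto (fun z => ∑' j, (1 - ‖blaschkeFactor (a j) z‖))
      (𝓝[Metric.ball (0 : ℂ) 1] (p : ℂ)) (𝓝 (∑' _ : ι, (0 : ℝ))) := by
    refine tendsto_tsum_of_dominated_convergence (hs.mul_right (2 / (ε / 2))) (fun j => ?_) ?_
    · have hden : ‖1 - conj (a j) * p‖ = ‖a j - p‖ := by
        have := sq_norm_one_sub_conj_mul_sub (a j) p
        rw [Circle.norm_coe] at this
        exact (pow_left_inj₀ (norm_nonneg _) (norm_nonneg _) two_ne_zero).1 (by linarith)
      have hpos : 0 < ‖a j - p‖ := hε.trans_le (hfar j)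
      have hval : ‖blaschkeFactor (a j) p‖ = 1 := by
        rw [norm_blaschkeFactor (ha j).1, hden, div_self hpos.ne']
      have hne0 : 1 - conj (a j) * (p : ℂ) ≠ 0 := by
        rw [← norm_pos_iff, hden]
        exact hpos
      have hcont : ContinuousAt (fun z => 1 - ‖blaschkeFactor (a j) z‖) (p : ℂ) := by
        unfold blaschkeFactor
        fun_prop (disch := assumption)
      have := hcont.tendsto.mono_left (nhdsWithin_le_nhds (s := Metric.ball (0 : ℂ) 1))
      rwa [hval, sub_self] at this
    · filter_upwards [hnear, self_mem_nhdsWithin] with z hz hzb j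
      have hz1 := mem_ball_zero_iff.1 hzb
      have hdist : ε / 2 ≤ ‖1 - conj (a j) * z‖ := by
        refine le_trans ?_ (norm_sub_le_norm_one_sub_conj_mul (ha j).2.le hz1.le)
        have := norm_sub_le_norm_sub_add_norm_sub (a j) z (p : ℂ)
        linarith [hfar j]
      have h1 := norm_blaschkeFactor_sub_one_le (ha j).1 (ha j).2.le hz1.le (half_pos hε) hdist
      have h2 := norm_sub_norm_le (1 : ℂ) (blaschkeFactor (a j) z)
      rw [norm_one, norm_sub_rev] at h2
      rw [Real.norm_of_nonneg
        (sub_nonneg.2 (norm_blaschkeFactor_le_one (ha j).1 (ha j).2.le hz1.le))]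
      linarith
  rw [tsum_zero] at hsum
  have hpow : Tendsto (fun z : ℂ => ‖z‖ ^ m) (𝓝[Metric.ball (0 : ℂ) 1] (p : ℂ)) (𝓝 1) := by
    have hcont : Continuous fun z : ℂ => ‖z‖ ^ m := by fun_prop
    have := (hcont.tendsto (p : ℂ)).mono_left (nhdsWithin_le_nhds (s := Metric.ball (0 : ℂ) 1))
    simpa [Circle.norm_coe] using this
  have hlow : Tendsto (fun z => ‖z‖ ^ m * (1 - ∑' j, (1 - ‖blaschkeFactor (a j) z‖)))
      (𝓝[Metric.ball (0 : ℂ) 1] (p : ℂ)) (𝓝 1) := by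
    simpa using hpow.mul (tendsto_const_nhds.sub hsum)
  refine tendsto_of_tendsto_of_tendsto_of_le_of_le' hlow tendsto_const_nhds ?_ ?_
  · filter_upwards [self_mem_nhdsWithin] with z hzb
    rw [hBeq z hzb, norm_mul, norm_mul, Circle.norm_coe, one_mul, norm_pow]
    gcongr
    exact one_sub_tsum_le_norm_tprod_blaschkeFactor ha hs (mem_ball_zero_iff.1 hzb)
  · filter_upwards [self_mem_nhdsWithin] with z hzb
    exact hB'.norm_le_one hzb

/-! ### The argument of the boundary values along an arc. -/

/-- A unimodular `C¹` function on an interval has a differentiable logarithm. -/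
lemma exists_hasDerivAt_lift {f : ℝ → ℂ} {α β : ℝ} (hf : ∀ t ∈ Ioo α β, ContDiffAt ℝ 1 f t)
    (h1 : ∀ t ∈ Ioo α β, ‖f t‖ = 1) :
    ∃ h : ℝ → ℝ, ∀ t ∈ Ioo α β, HasDerivAt h (deriv f t / f t).im t ∧
      f t = Complex.exp (h t * Complex.I) := by
  rcases (Ioo α β).eq_empty_or_nonempty with he | ⟨t₀, ht₀⟩
  · exact ⟨0, fun t ht => absurd ht (he ▸ notMem_empty t)⟩
  have hfd : ∀ t ∈ Ioo α β, HasDerivAt f (deriv f t) t := fun t ht =>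
    ((hf t ht).differentiableAt one_ne_zero).hasDerivAt
  have hf0 : ∀ t ∈ Ioo α β, f t ≠ 0 := fun t ht => by
    rw [← norm_pos_iff, h1 t ht]; exact one_pos
  set v : ℝ → ℝ := fun t => (deriv f t / f t).im with hv
  have hvc : ∀ t ∈ Ioo α β, ContinuousAt v t := by
    intro t ht
    have hd : ContinuousAt (deriv f) t := by
      have hOn : ContDiffOn ℝ 1 f (Ioo α β) := fun s hs => (hf s hs).contDiffWithinAt
      exact (hOn.continuousOn_deriv_of_isOpen isOpen_Ioo le_rfl).continuousAt
        (isOpen_Ioo.mem_nhds ht)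
    exact Complex.continuous_im.continuousAt.comp
      (hd.div (hfd t ht).continuousAt (hf0 t ht))
  -- As $|f|^2$ is constant, $f'/f$ is purely imaginary, so `v` carries all of it.
  have hre : ∀ t ∈ Ioo α β, (deriv f t / f t : ℂ) = v t * Complex.I := by
    intro t ht
    have hsq : HasDerivAt (fun s => ‖f s‖ ^ 2) (2 * inner ℝ (f t) (deriv f t)) t :=
      (hfd t ht).norm_sq
    have hcst : (fun s => ‖f s‖ ^ 2) =ᶠ[𝓝 t] fun _ => (1 : ℝ) := by
      filter_upwards [isOpen_Ioo.mem_nhds ht] with s hs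
      rw [h1 s hs, one_pow]
    have h0 := hsq.unique ((hasDerivAt_const t (1 : ℝ)).congr_of_eventuallyEq hcst)
    have hz : (deriv f t / f t : ℂ).re = 0 := by
      have hn : Complex.normSq (f t) = 1 := by rw [← Complex.sq_norm, h1 t ht, one_pow]
      rw [Complex.inner] at h0
      simp only [Complex.mul_re, Complex.conj_re, Complex.conj_im] at h0
      rw [Complex.div_re, hn]
      linarith
    apply Complex.ext <;> simp [hz, hv]
  obtain ⟨c, hc⟩ : ∃ c : ℝ, f t₀ = Complex.exp (c * Complex.I) := by
    refine ⟨(f t₀).arg, ?_⟩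
    have := Complex.norm_mul_exp_arg_mul_I (f t₀)
    rw [h1 t₀ ht₀] at this
    simpa using this.symm
  set h : ℝ → ℝ := fun t => c + ∫ s in t₀..t, v s with hh
  have hhd : ∀ t ∈ Ioo α β, HasDerivAt h (v t) t := by
    intro t ht
    have hsub : uIcc t₀ t ⊆ Ioo α β := ordConnected_Ioo.uIcc_subset ht₀ ht
    have hcon : ContinuousOn v (Ioo α β) := fun s hs => (hvc s hs).continuousWithinAt
    refine HasDerivAt.const_add c (intervalIntegral.integral_hasDerivAt_right
      (hcon.mono hsub).intervalIntegrable ?_ (hvc t ht))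
    exact hcon.stronglyMeasurableAtFilter isOpen_Ioo t ht
  refine ⟨h, fun t ht => ⟨hhd t ht, ?_⟩⟩
  -- This quotient of `f` by $e^{ih}$ has derivative zero and equals $1$ at `t₀`.
  set F : ℝ → ℂ := fun t => f t * Complex.exp (-(h t * Complex.I)) with hF
  have hFd : ∀ t ∈ Ioo α β, HasDerivAt F 0 t := by
    intro t ht
    have he : HasDerivAt (fun t => Complex.exp (-(h t * Complex.I)))
        (Complex.exp (-(h t * Complex.I)) * -((v t : ℂ) * Complex.I)) t :=
      (((hhd t ht).ofReal_comp.mul_const Complex.I).neg).cexp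
    have := hre t ht
    rw [div_eq_iff (hf0 t ht)] at this
    refine ((hfd t ht).mul he).congr_deriv ?_
    rw [this]
    ring
  have hconst : F t = F t₀ :=
    isOpen_Ioo.is_const_of_deriv_eq_zero isPreconnected_Ioo
      (fun s hs => (hFd s hs).differentiableAt.differentiableWithinAt)
      (fun s hs => (hFd s hs).deriv) ht ht₀
  have hF0 : F t₀ = 1 := by
    simp only [hF, hh, intervalIntegral.integral_same, add_zero, hc]
    rw [← Complex.exp_add, add_neg_cancel, Complex.exp_zero]
  rw [hF0] at hconst
  simp only [hF, Complex.exp_neg] at hconst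
  rwa [mul_inv_eq_one₀ (Complex.exp_ne_zero _)] at hconst

lemma hasDerivAt_comp_circleExp {g : ℂ → ℂ} {t : ℝ} (hg : AnalyticAt ℂ g (Circle.exp t)) :
    HasDerivAt (fun s : ℝ => g (Circle.exp s))
      (deriv g (Circle.exp t) * (Circle.exp t * Complex.I)) t := by
  have h1 : HasDerivAt (fun s : ℝ => ((Circle.exp s : Circle) : ℂ))
      ((Circle.exp t : ℂ) * Complex.I) t := by
    simp only [Circle.coe_exp]
    simpa using ((Complex.ofRealCLM.hasDerivAt (x := t)).mul_const Complex.I).cexp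
  exact HasDerivAt.comp (𝕜 := ℝ) (h₂ := g) t hg.differentiableAt.hasDerivAt h1

lemma boundaryValue_comp_exp_eventuallyEq {B g : ℂ → ℂ} {t : ℝ}
    (hg : AnalyticAt ℂ g (Circle.exp t))
    (h : ∀ᶠ z in 𝓝[Metric.ball (0 : ℂ) 1] (Circle.exp t : ℂ), g z = B z) :
    (fun s => boundaryValue B (Circle.exp s)) =ᶠ[𝓝 t] fun s => g (Circle.exp s) := by
  have hc : Tendsto (fun s : ℝ => Circle.exp s) (𝓝 t) (𝓝 (Circle.exp t)) :=
    Circle.exp.continuous.continuousAt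
  filter_upwards [hc.eventually (eventually_boundaryValue_eq hg h)] with s hs using hs.2

lemma contDiffAt_boundaryValue {B : ℂ → ℂ} {t : ℝ} (ht : Circle.exp t ∉ singularSet B) :
    ContDiffAt ℝ 1 (fun s => boundaryValue B (Circle.exp s)) t := by
  obtain ⟨g, hg, h⟩ := not_not.1 ht
  refine ContDiffAt.congr_of_eventuallyEq ?_ (boundaryValue_comp_exp_eventuallyEq hg h)
  have h1 : ContDiffAt ℝ 1 (fun s : ℝ => ((Circle.exp s : Circle) : ℂ)) t := by
    simp only [Circle.coe_exp]
    exact ((Complex.ofRealCLM.contDiff.mul contDiff_const).cexp).contDiffAt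
  exact (hg.contDiffAt.restrict_scalars ℝ).comp t h1

/-- The argument of the boundary values does not decrease. -/
lemma IsBlaschkeProduct.im_logDeriv_boundaryValue_nonneg {B : ℂ → ℂ} (hB : IsBlaschkeProduct B)
    (hne : (singularSet B).Nonempty) {t : ℝ} (ht : Circle.exp t ∉ singularSet B) :
    0 ≤ (deriv (fun s => boundaryValue B (Circle.exp s)) t / boundaryValue B (Circle.exp t)).im := by
  obtain ⟨g, hg, h⟩ := not_not.1 ht
  have hn := hB.norm_boundaryValue hne ht
  rw [(boundaryValue_comp_exp_eventuallyEq hg h).deriv_eq, (hasDerivAt_comp_circleExp hg).deriv]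
  rw [boundaryValue_eq_of_analyticAt hg h] at hn ⊢
  set p : ℂ := (Circle.exp t : ℂ) with hp
  have hpn : ‖p‖ = 1 := Circle.norm_coe _
  -- The tangential derivative is $i$ times the radial one, so the quantity in question is the real
  -- part of the radial logarithmic derivative. That is nonnegative because $|g(rp)|\le 1$ for $r<1$
  -- close to $1$, with equality at $r=1$.
  have hr : HasDerivAt (fun r : ℝ => g (r * p)) (deriv g p * p) 1 := by
    have h1 : HasDerivAt (fun r : ℝ => (r : ℂ) * p) p 1 := by
      simpa using (Complex.ofRealCLM.hasDerivAt (x := (1 : ℝ))).mul_const p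
    have hg' : HasDerivAt g (deriv g p) (((1 : ℝ) : ℂ) * p) := by
      simpa using hg.differentiableAt.hasDerivAt
    exact HasDerivAt.comp (𝕜 := ℝ) (h₂ := g) (1 : ℝ) hg' h1
  have hsq := hr.norm_sq
  have hle : ∀ᶠ r : ℝ in 𝓝[<] (1 : ℝ), ‖g (r * p)‖ ^ 2 ≤ 1 := by
    have hlim : Tendsto (fun r : ℝ => (r : ℂ) * p) (𝓝[<] (1 : ℝ)) (𝓝[Metric.ball (0 : ℂ) 1] p) := by
      refine tendsto_nhdsWithin_iff.2 ⟨?_, ?_⟩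
      · have : Continuous fun r : ℝ => (r : ℂ) * p := by fun_prop
        simpa using (this.tendsto (1 : ℝ)).mono_left (nhdsWithin_le_nhds (s := Iio (1 : ℝ)))
      · filter_upwards [Ioo_mem_nhdsLT (zero_lt_one : (0 : ℝ) < 1)] with r hr
        rw [mem_ball_zero_iff, norm_mul, hpn, mul_one, Complex.norm_real,
          Real.norm_of_nonneg hr.1.le]
        exact hr.2
    filter_upwards [hlim.eventually (h.and self_mem_nhdsWithin)] with r hr
    rw [hr.1]
    exact pow_le_one₀ (norm_nonneg _) (hB.norm_le_one hr.2)
  have hpos : 0 ≤ 2 * inner ℝ (g (((1 : ℝ) : ℂ) * p)) (deriv g p * p) := by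
    have hslope := (hasDerivAt_iff_tendsto_slope.1 hsq).mono_left
      (nhdsWithin_mono (1 : ℝ) (fun r (hr : r ∈ Iio (1 : ℝ)) => ne_of_lt hr))
    refine ge_of_tendsto hslope ?_
    filter_upwards [hle, self_mem_nhdsWithin] with r hr hr1
    rw [slope_def_field]
    refine div_nonneg_of_nonpos ?_ (sub_nonpos.2 (le_of_lt hr1))
    simp only [Complex.ofReal_one, one_mul, hn]
    linarith
  rw [Complex.ofReal_one, one_mul, Complex.inner] at hpos
  have hns : Complex.normSq (g p) = 1 := by rw [← Complex.sq_norm, hn, one_pow]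
  rw [Complex.div_im, hns]
  simp only [Complex.mul_re, Complex.mul_im, Complex.conj_re, Complex.conj_im, Complex.I_re,
    Complex.I_im] at hpos ⊢
  linarith

/-- On an arc of regular points the boundary values have a continuous strictly increasing
argument. -/
lemma IsBlaschkeProduct.exists_strictMonoOn_lift {B : ℂ → ℂ} (hB : IsBlaschkeProduct B)
    (hne : (singularSet B).Nonempty) {α β : ℝ}
    (hreg : ∀ t ∈ Ioo α β, Circle.exp t ∉ singularSet B) :
    ∃ h : ℝ → ℝ, ContinuousOn h (Ioo α β) ∧ StrictMonoOn h (Ioo α β) ∧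
      ∀ t ∈ Ioo α β, boundaryValue B (Circle.exp t) = Circle.exp (h t) := by
  obtain ⟨h, hh⟩ := exists_hasDerivAt_lift (fun t ht => contDiffAt_boundaryValue (hreg t ht))
    (fun t ht => hB.norm_boundaryValue hne (hreg t ht))
  have hcont : ContinuousOn h (Ioo α β) := fun t ht => (hh t ht).1.continuousAt.continuousWithinAt
  have hmono : MonotoneOn h (Ioo α β) := by
    refine monotoneOn_of_deriv_nonneg (convex_Ioo α β) hcont ?_ ?_ <;> rw [interior_Ioo]
    · exact fun t ht => (hh t ht).1.differentiableAt.differentiableWithinAt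
    · intro t ht
      rw [(hh t ht).1.deriv]
      exact hB.im_logDeriv_boundaryValue_nonneg hne (hreg t ht)
  refine ⟨h, hcont, fun s hs t ht hst => ?_, fun t ht => by rw [(hh t ht).2, Circle.coe_exp]⟩
  -- Equal values at `s` and `t` would make `h` constant between them, hence the analytic extension
  -- constant on a piece of the circle, and by the identity theorem constant near a point of it.
  refine (hmono hs ht hst.le).lt_of_ne fun heq => ?_
  obtain ⟨u, hsu, hut⟩ := exists_between hst
  have hu : u ∈ Ioo α β := ⟨hs.1.trans hsu, hut.trans ht.2⟩
  obtain ⟨g, hg, hgB⟩ := not_not.1 (hreg u hu)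
  have hconst : ∀ᶠ r in 𝓝 u, g (Circle.exp r) = Complex.exp (h s * Complex.I) := by
    filter_upwards [boundaryValue_comp_exp_eventuallyEq hg hgB, Ioo_mem_nhds hsu hut] with r hr hr'
    have hr2 : r ∈ Ioo α β := ⟨hs.1.trans hr'.1, hr'.2.trans ht.2⟩
    rw [← hr, (hh r hr2).2]
    have h1 := hmono hs hr2 hr'.1.le
    have h2 := hmono hr2 ht hr'.2.le
    rw [le_antisymm (h2.trans heq.ge) h1]
  refine hB.not_eventually_const hne (Complex.exp (h s * Complex.I)) hgB
    ((hg.frequently_eq_iff_eventually_eq analyticAt_const).1 ?_)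
  -- The identity theorem needs points of the circle other than the centre; the parametrisation does
  -- not return to $e^{iu}$ within distance $1<2\pi$ of `u`.
  have hinj : ∀ᶠ r in 𝓝[≠] u, ((Circle.exp r : Circle) : ℂ) ≠ Circle.exp u := by
    have hball : Metric.ball u 1 ∈ 𝓝 u := Metric.ball_mem_nhds u one_pos
    filter_upwards [self_mem_nhdsWithin, nhdsWithin_le_nhds hball] with r hr hr1 heq'
    obtain ⟨m, hm⟩ := Circle.exp_eq_exp.1 (Circle.coe_injective heq')
    rw [Metric.mem_ball, Real.dist_eq, hm, add_sub_cancel_left, abs_lt] at hr1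
    have hpi := Real.pi_gt_three
    have hm1 : m < 1 := by
      by_contra hcon
      have : (1 : ℝ) ≤ m := by exact_mod_cast not_lt.1 hcon
      nlinarith [hr1.2]
    have hm2 : -1 < m := by
      by_contra hcon
      have : (m : ℝ) ≤ -1 := by exact_mod_cast not_lt.1 hcon
      nlinarith [hr1.1]
    obtain rfl : m = 0 := by omega
    exact hr (by simpa using hm)
  have hlim : Tendsto (fun r : ℝ => ((Circle.exp r : Circle) : ℂ)) (𝓝[≠] u)
      (𝓝[≠] (Circle.exp u : ℂ)) := by
    refine tendsto_nhdsWithin_iff.2 ⟨?_, hinj⟩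
    have : Continuous fun r : ℝ => ((Circle.exp r : Circle) : ℂ) := by fun_prop
    exact (this.tendsto u).mono_left nhdsWithin_le_nhds
  exact hlim.frequently (hconst.filter_mono nhdsWithin_le_nhds).frequently

/-! ### The range of the argument determines the type of the arc. -/

/-- `h` is a continuous strictly increasing argument of the boundary values of `B` on the arc
`(α, β)`. -/
structure IsArgLift (B : ℂ → ℂ) (h : ℝ → ℝ) (α β : ℝ) : Prop where
  lt : α < β
  continuousOn : ContinuousOn h (Ioo α β)
  strictMonoOn : StrictMonoOn h (Ioo α β)
  eq_exp : ∀ t ∈ Ioo α β, boundaryValue B (Circle.exp t) = Circle.exp (h t)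

lemma finite_setOf_exp_eq_one (a b : ℝ) :
    {u ∈ Icc a b | ((Circle.exp u : Circle) : ℂ) = 1}.Finite := by
  have hpi := Real.two_pi_pos
  refine ((Set.finite_Icc ⌈a / (2 * Real.pi)⌉ ⌊b / (2 * Real.pi)⌋).image
    fun m : ℤ => (m : ℝ) * (2 * Real.pi)).subset ?_
  rintro u ⟨⟨hau, hub⟩, hu⟩
  obtain ⟨m, rfl⟩ := Circle.exp_eq_one.1 (Circle.coe_injective (by simpa using hu))
  exact ⟨m, ⟨Int.ceil_le.2 ((div_le_iff₀ hpi).2 hau), Int.le_floor.2 ((le_div_iff₀ hpi).2 hub)⟩,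
    rfl⟩

namespace IsArgLift

variable {B : ℂ → ℂ} {h : ℝ → ℝ} {α β : ℝ} (H : IsArgLift B h α β)
include H

lemma ordConnected : (h '' Ioo α β).OrdConnected :=
  (isPreconnected_Ioo.image h H.continuousOn).ordConnected

lemma nonempty : (h '' Ioo α β).Nonempty := (nonempty_Ioo.2 H.lt).image h

lemma exists_gt {u : ℝ} (hu : u ∈ h '' Ioo α β) : ∃ v ∈ h '' Ioo α β, u < v := by
  obtain ⟨t, ht, rfl⟩ := hu
  obtain ⟨s, hs, hs'⟩ := exists_between ht.2
  have hm : s ∈ Ioo α β := ⟨ht.1.trans hs, hs'⟩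
  exact ⟨_, mem_image_of_mem h hm, H.strictMonoOn ht hm hs⟩

lemma exists_lt {u : ℝ} (hu : u ∈ h '' Ioo α β) : ∃ v ∈ h '' Ioo α β, v < u := by
  obtain ⟨t, ht, rfl⟩ := hu
  obtain ⟨s, hs, hs'⟩ := exists_between ht.1
  have hm : s ∈ Ioo α β := ⟨hs, hs'.trans ht.2⟩
  exact ⟨_, mem_image_of_mem h hm, H.strictMonoOn hm ht hs'⟩

lemma lt_csSup (hb : BddAbove (h '' Ioo α β)) {u : ℝ} (hu : u ∈ h '' Ioo α β) :
    u < sSup (h '' Ioo α β) := by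
  obtain ⟨v, hv, huv⟩ := H.exists_gt hu
  exact huv.trans_le (le_csSup hb hv)

lemma csInf_lt (hb : BddBelow (h '' Ioo α β)) {u : ℝ} (hu : u ∈ h '' Ioo α β) :
    sInf (h '' Ioo α β) < u := by
  obtain ⟨v, hv, huv⟩ := H.exists_lt hu
  exact (csInf_le hb hv).trans_lt huv

/-- The range is an interval without least or greatest element. Boundedness below and above gives
four possible shapes, one for each type. -/
lemma image_eq_univ (h1 : ¬ BddBelow (h '' Ioo α β)) (h2 : ¬ BddAbove (h '' Ioo α β)) :
    h '' Ioo α β = univ := by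
  refine eq_univ_of_forall fun u => ?_
  obtain ⟨v, hv, hvu⟩ := not_bddBelow_iff.1 h1 u
  obtain ⟨w, hw, huw⟩ := not_bddAbove_iff.1 h2 u
  exact H.ordConnected.out hv hw ⟨hvu.le, huw.le⟩

lemma image_eq_Iio (h1 : ¬ BddBelow (h '' Ioo α β)) (h2 : BddAbove (h '' Ioo α β)) :
    h '' Ioo α β = Iio (sSup (h '' Ioo α β)) := by
  refine Subset.antisymm (fun u hu => H.lt_csSup h2 hu) fun u hu => ?_
  obtain ⟨v, hv, hvu⟩ := not_bddBelow_iff.1 h1 u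
  obtain ⟨w, hw, huw⟩ := exists_lt_of_lt_csSup H.nonempty hu
  exact H.ordConnected.out hv hw ⟨hvu.le, huw.le⟩

lemma image_eq_Ioi (h1 : BddBelow (h '' Ioo α β)) (h2 : ¬ BddAbove (h '' Ioo α β)) :
    h '' Ioo α β = Ioi (sInf (h '' Ioo α β)) := by
  refine Subset.antisymm (fun u hu => H.csInf_lt h1 hu) fun u hu => ?_
  obtain ⟨v, hv, hvu⟩ := exists_lt_of_csInf_lt H.nonempty hu
  obtain ⟨w, hw, huw⟩ := not_bddAbove_iff.1 h2 u
  exact H.ordConnected.out hv hw ⟨hvu.le, huw.le⟩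

lemma image_eq_Ioo (h1 : BddBelow (h '' Ioo α β)) (h2 : BddAbove (h '' Ioo α β)) :
    h '' Ioo α β = Ioo (sInf (h '' Ioo α β)) (sSup (h '' Ioo α β)) := by
  refine Subset.antisymm (fun u hu => ⟨H.csInf_lt h1 hu, H.lt_csSup h2 hu⟩) fun u hu => ?_
  obtain ⟨v, hv, hvu⟩ := exists_lt_of_csInf_lt H.nonempty hu.1
  obtain ⟨w, hw, huw⟩ := exists_lt_of_lt_csSup H.nonempty hu.2
  exact H.ordConnected.out hv hw ⟨hvu.le, huw.le⟩

/-- Since `h` is injective on the arc, multiplicities can be counted in the range, where only the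
exponential is involved. -/
lemma encard_solutions (w : ℂ) :
    (solutions B w α β).encard =
      {u ∈ h '' Ioo α β | ((Circle.exp u : Circle) : ℂ) = w}.encard := by
  have : h '' solutions B w α β = {u ∈ h '' Ioo α β | ((Circle.exp u : Circle) : ℂ) = w} := by
    ext u
    constructor
    · rintro ⟨t, ⟨ht, hw⟩, rfl⟩
      exact ⟨mem_image_of_mem h ht, by rw [← H.eq_exp t ht, hw]⟩
    · rintro ⟨⟨t, ht, rfl⟩, hw⟩
      exact ⟨t, ⟨ht, by rw [H.eq_exp t ht, hw]⟩, rfl⟩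
  rw [← this, (H.strictMonoOn.injOn.mono fun t ht => ht.1).encard_image]

lemma finite_solutions_of_bounded (a b : ℝ) :
    {t ∈ solutions B 1 α β | h t ∈ Icc a b}.Finite := by
  refine Set.Finite.of_finite_image ((finite_setOf_exp_eq_one a b).subset ?_)
    (H.strictMonoOn.injOn.mono fun t ht => ht.1.1)
  rintro _ ⟨t, ⟨⟨ht, h1⟩, hI⟩, rfl⟩
  exact ⟨hI, by rw [← H.eq_exp t ht, h1]⟩

lemma exists_solution_between {u v : ℝ} (hu : u ∈ h '' Ioo α β) (hv : v ∈ h '' Ioo α β)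
    (huv : u + 2 * Real.pi < v) : ∃ t ∈ solutions B 1 α β, u < h t ∧ h t < v := by
  have hpi := Real.two_pi_pos
  -- The least multiple of $2\pi$ beyond `u`; it is at most $u+2\pi$.
  set m : ℤ := ⌊u / (2 * Real.pi)⌋ + 1 with hm
  have h1 : u < m * (2 * Real.pi) := by
    rw [← div_lt_iff₀ hpi, hm]; push_cast; exact Int.lt_floor_add_one _
  have h2 : m * (2 * Real.pi) ≤ u + 2 * Real.pi := by
    have := (le_div_iff₀ hpi).1 (Int.floor_le (u / (2 * Real.pi)))
    rw [hm]; push_cast; linarith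
  obtain ⟨t, ht, hht⟩ := H.ordConnected.out hu hv ⟨h1.le, (h2.trans_lt huv).le⟩
  refine ⟨t, ⟨ht, ?_⟩, by rw [hht]; exact h1, by rw [hht]; linarith⟩
  rw [H.eq_exp t ht, hht, Circle.exp_int_mul_two_pi, Circle.coe_one]

/-- Solutions have `h`-values in $2\pi\mathbb Z$. If `h` is bounded above, only finitely many of
them lie beyond a given point; if not, `h` grows by more than $2\pi$ in every left neighbourhood of
`β` and so meets a solution there. -/
lemma accPt_right_iff : AccPt β (𝓟 (solutions B 1 α β)) ↔ ¬ BddAbove (h '' Ioo α β) := by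
  constructor
  · rintro hacc ⟨b, hb⟩
    obtain ⟨t₀, ht₀⟩ := nonempty_Ioo.2 H.lt
    refine (Set.Infinite.of_accPt (hacc.nhds_inter (Ioi_mem_nhds ht₀.2)))
      ((H.finite_solutions_of_bounded (h t₀) b).subset ?_)
    rintro t ⟨ht₀t, ht⟩
    exact ⟨ht, (H.strictMonoOn ht₀ ht.1 ht₀t).le, hb (mem_image_of_mem h ht.1)⟩
  · intro hb
    rw [accPt_iff_nhds]
    intro U hU
    obtain ⟨l, hl, hlU⟩ := exists_Ioc_subset_of_mem_nhds hU ⟨α, H.lt⟩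
    obtain ⟨s, hs, hs'⟩ := exists_between (max_lt hl H.lt)
    have hsm : s ∈ Ioo α β := ⟨(le_max_right _ _).trans_lt hs, hs'⟩
    obtain ⟨v, hv, hsv⟩ := not_bddAbove_iff.1 hb (h s + 2 * Real.pi)
    obtain ⟨t, ht, hst, -⟩ := H.exists_solution_between (mem_image_of_mem h hsm) hv hsv
    have := (H.strictMonoOn.lt_iff_lt hsm ht.1).1 hst
    exact ⟨t, ⟨hlU ⟨((le_max_left _ _).trans_lt hs).trans this, ht.1.2.le⟩, ht⟩, ht.1.2.ne⟩

lemma accPt_left_iff : AccPt α (𝓟 (solutions B 1 α β)) ↔ ¬ BddBelow (h '' Ioo α β) := by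
  constructor
  · rintro hacc ⟨b, hb⟩
    obtain ⟨t₀, ht₀⟩ := nonempty_Ioo.2 H.lt
    refine (Set.Infinite.of_accPt (hacc.nhds_inter (Iio_mem_nhds ht₀.1)))
      ((H.finite_solutions_of_bounded b (h t₀)).subset ?_)
    rintro t ⟨ht₀t, ht⟩
    exact ⟨ht, hb (mem_image_of_mem h ht.1), (H.strictMonoOn ht.1 ht₀ ht₀t).le⟩
  · intro hb
    rw [accPt_iff_nhds]
    intro U hU
    obtain ⟨l, hl, hlU⟩ := exists_Ico_subset_of_mem_nhds hU ⟨β, H.lt⟩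
    obtain ⟨s, hs, hs'⟩ := exists_between (lt_min hl H.lt)
    have hsm : s ∈ Ioo α β := ⟨hs, hs'.trans_le (min_le_right _ _)⟩
    obtain ⟨v, hv, hsv⟩ := not_bddBelow_iff.1 hb (h s - 2 * Real.pi)
    obtain ⟨t, ht, -, hst⟩ :=
      H.exists_solution_between hv (mem_image_of_mem h hsm) (lt_sub_iff_add_lt.1 hsv)
    have := (H.strictMonoOn.lt_iff_lt ht.1 hsm).1 hst
    exact ⟨t, ⟨hlU ⟨ht.1.1.le, this.trans (hs'.trans_le (min_le_left _ _))⟩, ht⟩, ht.1.1.ne'⟩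

lemma eq_or_eq_of_accPt {t : ℝ} (hacc : AccPt t (𝓟 (solutions B 1 α β))) : t = α ∨ t = β := by
  have hcl : t ∈ Icc α β := by
    have := mem_closure_iff_clusterPt.2 hacc.clusterPt
    exact closure_minimal (fun s hs => Ioo_subset_Icc_self hs.1) isClosed_Icc this
  by_contra! hne
  have h1 : α < t := hcl.1.lt_of_ne' hne.1
  have h2 : t < β := hcl.2.lt_of_ne hne.2
  obtain ⟨t₁, hαt₁, ht₁t⟩ := exists_between h1
  obtain ⟨t₂, htt₂, ht₂β⟩ := exists_between h2
  refine (Set.Infinite.of_accPt (hacc.nhds_inter (Ioo_mem_nhds ht₁t htt₂)))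
    ((H.finite_solutions_of_bounded (h t₁) (h t₂)).subset ?_)
  rintro s ⟨⟨hs1, hs2⟩, hs⟩
  exact ⟨hs, (H.strictMonoOn ⟨hαt₁, ht₁t.trans h2⟩ hs.1 hs1).le,
    (H.strictMonoOn hs.1 ⟨h1.trans htt₂, ht₂β⟩ hs2).le⟩

lemma isType0_iff :
    IsType0 B α β ↔ BddBelow (h '' Ioo α β) ∧ BddAbove (h '' Ioo α β) := by
  constructor
  · intro hfin
    constructor
    · by_contra hb
      exact Set.Infinite.of_accPt (H.accPt_left_iff.2 hb) hfin
    · by_contra hb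
      exact Set.Infinite.of_accPt (H.accPt_right_iff.2 hb) hfin
  · rintro ⟨⟨a, ha⟩, ⟨b, hb⟩⟩
    exact (H.finite_solutions_of_bounded a b).subset fun t ht =>
      ⟨ht, ha (mem_image_of_mem h ht.1), hb (mem_image_of_mem h ht.1)⟩

lemma isType1a_iff :
    IsType1a B α β ↔ ¬ BddBelow (h '' Ioo α β) ∧ BddAbove (h '' Ioo α β) := by
  rw [IsType1a, Set.ext_iff]
  simp only [mem_ofPred_eq, mem_singleton_iff]
  constructor
  · rintro ⟨-, hS⟩
    refine ⟨H.accPt_left_iff.1 ((hS α).2 rfl), ?_⟩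
    by_contra hb
    exact H.lt.ne' ((hS β).1 (H.accPt_right_iff.2 hb))
  · rintro ⟨h1, h2⟩
    refine ⟨Set.Infinite.of_accPt (H.accPt_left_iff.2 h1), fun t => ⟨fun ht => ?_, ?_⟩⟩
    · refine (H.eq_or_eq_of_accPt ht).resolve_right ?_
      rintro rfl
      exact H.accPt_right_iff.1 ht h2
    · rintro rfl
      exact H.accPt_left_iff.2 h1

lemma isType1b_iff :
    IsType1b B α β ↔ BddBelow (h '' Ioo α β) ∧ ¬ BddAbove (h '' Ioo α β) := by
  rw [IsType1b, Set.ext_iff]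
  simp only [mem_ofPred_eq, mem_singleton_iff]
  constructor
  · rintro ⟨-, hS⟩
    refine ⟨?_, H.accPt_right_iff.1 ((hS β).2 rfl)⟩
    by_contra hb
    exact H.lt.ne ((hS α).1 (H.accPt_left_iff.2 hb))
  · rintro ⟨h1, h2⟩
    refine ⟨Set.Infinite.of_accPt (H.accPt_right_iff.2 h2), fun t => ⟨fun ht => ?_, ?_⟩⟩
    · refine (H.eq_or_eq_of_accPt ht).resolve_left ?_
      rintro rfl
      exact H.accPt_left_iff.1 ht h1
    · rintro rfl
      exact H.accPt_right_iff.2 h2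

lemma isType2_iff :
    IsType2 B α β ↔ ¬ BddBelow (h '' Ioo α β) ∧ ¬ BddAbove (h '' Ioo α β) := by
  rw [IsType2, Set.ext_iff]
  simp only [mem_ofPred_eq, mem_singleton_iff, mem_insert_iff]
  constructor
  · rintro ⟨-, hS⟩
    exact ⟨H.accPt_left_iff.1 ((hS α).2 (Or.inl rfl)),
      H.accPt_right_iff.1 ((hS β).2 (Or.inr rfl))⟩
  · rintro ⟨h1, h2⟩
    refine ⟨Set.Infinite.of_accPt (H.accPt_left_iff.2 h1),
      fun t => ⟨H.eq_or_eq_of_accPt, ?_⟩⟩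
    rintro (rfl | rfl)
    exacts [H.accPt_left_iff.2 h1, H.accPt_right_iff.2 h2]

lemma isType2_iff_image_eq_univ : IsType2 B α β ↔ h '' Ioo α β = univ := by
  rw [H.isType2_iff]
  refine ⟨fun ⟨h1, h2⟩ => H.image_eq_univ h1 h2, fun hu => ?_⟩
  rw [hu]
  exact ⟨not_bddBelow_univ, not_bddAbove_univ⟩

lemma tendsto_right (hb : BddAbove (h '' Ioo α β)) :
    Tendsto (fun t => boundaryValue B (Circle.exp t)) (𝓝[<] β)
      (𝓝 (Circle.exp (sSup (h '' Ioo α β)) : ℂ)) := by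
  have h1 := MonotoneOn.tendsto_nhdsWithin_Ioo_left (nonempty_Ioo.2 H.lt)
    H.strictMonoOn.monotoneOn hb
  have hc : Continuous fun u : ℝ => ((Circle.exp u : Circle) : ℂ) := by fun_prop
  refine ((hc.tendsto _).comp h1).congr' ?_
  filter_upwards [Ioo_mem_nhdsLT H.lt] with t ht using (H.eq_exp t ht).symm

lemma tendsto_left (hb : BddBelow (h '' Ioo α β)) :
    Tendsto (fun t => boundaryValue B (Circle.exp t)) (𝓝[>] α)
      (𝓝 (Circle.exp (sInf (h '' Ioo α β)) : ℂ)) := by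
  have h1 := MonotoneOn.tendsto_nhdsWithin_Ioo_right (nonempty_Ioo.2 H.lt)
    H.strictMonoOn.monotoneOn hb
  have hc : Continuous fun u : ℝ => ((Circle.exp u : Circle) : ℂ) := by fun_prop
  refine ((hc.tendsto _).comp h1).congr' ?_
  filter_upwards [Ioo_mem_nhdsGT H.lt] with t ht using (H.eq_exp t ht).symm

lemma sameType_of_image_eq {h' : ℝ → ℝ} {α' β' : ℝ} (H' : IsArgLift B h' α' β')
    (heq : h '' Ioo α β = h' '' Ioo α' β') : SameType B α β α' β' := by
  by_cases h1 : BddBelow (h '' Ioo α β) <;> by_cases h2 : BddAbove (h '' Ioo α β)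
  · refine Or.inl ⟨H.isType0_iff.2 ⟨h1, h2⟩, H'.isType0_iff.2 (heq ▸ ⟨h1, h2⟩), fun w => ?_⟩
    rw [H.encard_solutions, H'.encard_solutions, heq]
  · exact Or.inr (Or.inr (Or.inl ⟨H.isType1b_iff.2 ⟨h1, h2⟩,
      H'.isType1b_iff.2 (heq ▸ ⟨h1, h2⟩), _, H.tendsto_left h1,
      heq ▸ H'.tendsto_left (heq ▸ h1)⟩))
  · exact Or.inr (Or.inl ⟨H.isType1a_iff.2 ⟨h1, h2⟩,
      H'.isType1a_iff.2 (heq ▸ ⟨h1, h2⟩), _, H.tendsto_right h2,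
      heq ▸ H'.tendsto_right (heq ▸ h2)⟩)
  · exact Or.inr (Or.inr (Or.inr ⟨H.isType2_iff.2 ⟨h1, h2⟩, H'.isType2_iff.2 (heq ▸ ⟨h1, h2⟩)⟩))

end IsArgLift

/-! ### Normalisation modulo $2\pi$, and same type as equality of ranges. -/

/-- The interval `D` is normalised by a translation by a multiple of `2π`. -/
def IsNormalised (D : Set ℝ) : Prop :=
  (BddBelow D → sInf D ∈ Ico 0 (2 * Real.pi)) ∧
    (¬ BddBelow D → BddAbove D → sSup D ∈ Ico 0 (2 * Real.pi))

lemma eq_of_mem_Ico_two_pi {a b : ℝ} (ha : a ∈ Ico 0 (2 * Real.pi))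
    (hb : b ∈ Ico 0 (2 * Real.pi)) {m : ℤ} (h : a = b + m * (2 * Real.pi)) : m = 0 := by
  have hpi := Real.pi_pos
  have hm1 : m < 1 := by
    by_contra hcon
    have : (1 : ℝ) ≤ m := by exact_mod_cast not_lt.1 hcon
    nlinarith [ha.2, hb.1]
  have hm2 : -1 < m := by
    by_contra hcon
    have : (m : ℝ) ≤ -1 := by exact_mod_cast not_lt.1 hcon
    nlinarith [ha.1, hb.2]
  omega

/-- The numbers of integers in the translates of two intervals determine the intervals up to
an integer translation. -/
lemma exists_int_translate {a b a' b' : ℝ}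
    (h : ∀ v : ℝ, ⌈b - v⌉ - ⌊a - v⌋ = ⌈b' - v⌉ - ⌊a' - v⌋) :
    ∃ m : ℤ, a' = a + m ∧ b' = b + m := by
  -- Moving `v` from `a` to `a + ε` lowers `⌊a - v⌋` from $0$ to $-1$ and, for small `ε`, leaves
  -- both ceilings unchanged. So `⌊a' - v⌋` must drop as well, which for small `ε` forces $a'-a$ to
  -- be an integer.
  have hint : Int.fract (a' - a) = 0 := by
    by_contra hne
    have hpos : 0 < Int.fract (a' - a) := (Int.fract_nonneg _).lt_of_ne' hne
    obtain ⟨ε, hε, hεlt⟩ := exists_between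
      (show (0 : ℝ) < min (Int.fract (a' - a))
        (min (b - a - ⌈b - a⌉ + 1) (b' - a - ⌈b' - a⌉ + 1)) by
        refine lt_min hpos (lt_min ?_ ?_)
        · linarith [Int.ceil_lt_add_one (b - a)]
        · linarith [Int.ceil_lt_add_one (b' - a)])
    simp only [lt_min_iff] at hεlt
    obtain ⟨h1, h2, h3⟩ := hεlt
    have hε1 : ε < 1 := h1.trans (Int.fract_lt_one _)
    have e1 : ⌈b - (a + ε)⌉ = ⌈b - a⌉ := by
      rw [Int.ceil_eq_iff]
      constructor <;> linarith [Int.le_ceil (b - a)]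
    have e2 : ⌈b' - (a + ε)⌉ = ⌈b' - a⌉ := by
      rw [Int.ceil_eq_iff]
      constructor <;> linarith [Int.le_ceil (b' - a)]
    have e3 : ⌊a' - (a + ε)⌋ = ⌊a' - a⌋ := by
      rw [Int.floor_eq_iff]
      have := Int.self_sub_floor (a' - a)
      constructor <;> linarith [Int.lt_floor_add_one (a' - a)]
    have e4 : ⌊a - (a + ε)⌋ = -1 := by
      rw [Int.floor_eq_iff]
      push_cast
      constructor <;> linarith
    have f1 := h a
    have f2 := h (a + ε)
    rw [e1, e2, e3, e4] at f2
    rw [sub_self, Int.floor_zero] at f1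
    omega
  refine ⟨⌊a' - a⌋, ?_, ?_⟩
  · have := Int.self_sub_floor (a' - a)
    linarith
  set m : ℤ := ⌊a' - a⌋ with hm
  have ha' : a' = a + m := by
    have := Int.self_sub_floor (a' - a)
    linarith
  have key : ∀ v : ℝ, ⌈b - v⌉ = ⌈b' - m - v⌉ := by
    intro v
    have h1 := h v
    have h2 : ⌊a' - v⌋ = ⌊a - v⌋ + m := by
      rw [← Int.floor_add_intCast]; congr 1; linarith
    have h3 : ⌈b' - m - v⌉ = ⌈b' - v⌉ - m := by
      rw [← Int.ceil_sub_intCast]; congr 1; linarith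
    omega
  -- These two values of `v` give the two inequalities between `b` and `b' - m`.
  have k1 := key b
  have k2 := key (b' - m)
  rw [sub_self, Int.ceil_zero] at k1 k2
  have l1 := Int.le_ceil (b' - m - b)
  have l2 := Int.le_ceil (b - (b' - m))
  rw [← k1] at l1
  rw [k2] at l2
  push_cast at l1 l2
  linarith

lemma encard_setOf_mem_Ioo_exp_eq {a b : ℝ} (v : ℝ) :
    {u ∈ Ioo a b | ((Circle.exp u : Circle) : ℂ) = Circle.exp v}.encard =
      ((⌈(b - v) / (2 * Real.pi)⌉ - ⌊(a - v) / (2 * Real.pi)⌋ - 1).toNat : ℕ∞) := by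
  have hpi := Real.two_pi_pos
  have hset : {u ∈ Ioo a b | ((Circle.exp u : Circle) : ℂ) = Circle.exp v} =
      (fun m : ℤ => v + m * (2 * Real.pi)) ''
        (Finset.Ioo ⌊(a - v) / (2 * Real.pi)⌋ ⌈(b - v) / (2 * Real.pi)⌉ : Set ℤ) := by
    ext u
    simp only [mem_ofPred_eq, mem_image, Finset.coe_Ioo, mem_Ioo, Int.floor_lt, Int.lt_ceil,
      div_lt_iff₀ hpi, lt_div_iff₀ hpi]
    constructor
    · rintro ⟨⟨h1, h2⟩, hu⟩
      obtain ⟨m, rfl⟩ := Circle.exp_eq_exp.1 (Circle.coe_injective hu)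
      exact ⟨m, ⟨by linarith, by linarith⟩, rfl⟩
    · rintro ⟨m, ⟨h1, h2⟩, rfl⟩
      refine ⟨⟨by linarith, by linarith⟩, ?_⟩
      rw [Circle.exp_eq_exp.2 ⟨m, rfl⟩]
  have hinj : Function.Injective fun m : ℤ => v + m * (2 * Real.pi) := by
    intro m m' hmm
    have := mul_right_cancel₀ hpi.ne' (add_left_cancel hmm)
    exact_mod_cast this
  rw [hset, hinj.encard_image, encard_coe_eq_coe_finsetCard, Int.card_Ioo]

/-- In units of $2\pi$ and with $w=e^{2\pi iv}$, the hypothesis compares the numbers of integers in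
the two intervals translated by $-v$, for every $v$. -/
lemma eq_of_encard_exp_eq {a b a' b' : ℝ} (hab : a < b) (hab' : a' < b')
    (h : ∀ w : ℂ, {u ∈ Ioo a b | ((Circle.exp u : Circle) : ℂ) = w}.encard =
      {u ∈ Ioo a' b' | ((Circle.exp u : Circle) : ℂ) = w}.encard) :
    ∃ m : ℤ, a' = a + m * (2 * Real.pi) ∧ b' = b + m * (2 * Real.pi) := by
  have hpi := Real.two_pi_pos
  -- Makes the counts nonnegative before truncation, so that `toNat` loses nothing.
  have hcl : ∀ x y : ℝ, x < y → ⌊x⌋ + 1 ≤ ⌈y⌉ := fun x y hxy =>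
    Int.add_one_le_iff.2 (by
      have := (Int.floor_le x).trans_lt (hxy.trans_le (Int.le_ceil y))
      exact_mod_cast this)
  obtain ⟨m, h1, h2⟩ := exists_int_translate (a := a / (2 * Real.pi)) (b := b / (2 * Real.pi))
    (a' := a' / (2 * Real.pi)) (b' := b' / (2 * Real.pi)) fun v => by
    have hv := h (Circle.exp (v * (2 * Real.pi)))
    rw [encard_setOf_mem_Ioo_exp_eq, encard_setOf_mem_Ioo_exp_eq, Nat.cast_inj] at hv
    have hdiv : ∀ x : ℝ, (x - v * (2 * Real.pi)) / (2 * Real.pi) = x / (2 * Real.pi) - v := by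
      intro x
      rw [sub_div, mul_div_cancel_right₀ _ hpi.ne']
    simp only [hdiv] at hv
    have c1 := hcl (a / (2 * Real.pi) - v) (b / (2 * Real.pi) - v) (by gcongr)
    have c2 := hcl (a' / (2 * Real.pi) - v) (b' / (2 * Real.pi) - v) (by gcongr)
    omega
  refine ⟨m, ?_, ?_⟩
  · field_simp at h1
    linarith
  · field_simp at h2
    linarith

/-- The type gives the shape of the range, the multiplicities or one-sided limits fix its finite
ends up to a common multiple of $2\pi$, and the normalisation removes that multiple. -/
lemma IsArgLift.image_eq_of_sameType {B : ℂ → ℂ} {h h' : ℝ → ℝ} {α β α' β' : ℝ}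
    (H : IsArgLift B h α β) (H' : IsArgLift B h' α' β') (hn : IsNormalised (h '' Ioo α β))
    (hn' : IsNormalised (h' '' Ioo α' β')) (hst : SameType B α β α' β') :
    h '' Ioo α β = h' '' Ioo α' β' := by
  rcases hst with ⟨h0, h0', hw⟩ | ⟨h0, h0', L, hL, hL'⟩ | ⟨h0, h0', L, hL, hL'⟩ | ⟨h0, h0'⟩
  · rw [H.isType0_iff] at h0
    rw [H'.isType0_iff] at h0'
    simp only [H.encard_solutions, H'.encard_solutions] at hw
    rw [H.image_eq_Ioo h0.1 h0.2, H'.image_eq_Ioo h0'.1 h0'.2] at hw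
    obtain ⟨u, hu⟩ := H.nonempty
    obtain ⟨u', hu'⟩ := H'.nonempty
    obtain ⟨m, h1, h2⟩ := eq_of_encard_exp_eq
      ((H.csInf_lt h0.1 hu).trans (H.lt_csSup h0.2 hu))
      ((H'.csInf_lt h0'.1 hu').trans (H'.lt_csSup h0'.2 hu')) hw
    obtain rfl := eq_of_mem_Ico_two_pi (hn'.1 h0'.1) (hn.1 h0.1) h1
    rw [H.image_eq_Ioo h0.1 h0.2, H'.image_eq_Ioo h0'.1 h0'.2, h1, h2]
    simp
  · rw [H.isType1a_iff] at h0
    rw [H'.isType1a_iff] at h0'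
    have e1 := tendsto_nhds_unique hL (H.tendsto_right h0.2)
    have e2 := tendsto_nhds_unique hL' (H'.tendsto_right h0'.2)
    obtain ⟨m, hm⟩ := Circle.exp_eq_exp.1 (Circle.coe_injective (e1.symm.trans e2))
    obtain rfl := eq_of_mem_Ico_two_pi (hn.2 h0.1 h0.2) (hn'.2 h0'.1 h0'.2) hm
    rw [H.image_eq_Iio h0.1 h0.2, H'.image_eq_Iio h0'.1 h0'.2, hm]
    simp
  · rw [H.isType1b_iff] at h0
    rw [H'.isType1b_iff] at h0'
    have e1 := tendsto_nhds_unique hL (H.tendsto_left h0.1)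
    have e2 := tendsto_nhds_unique hL' (H'.tendsto_left h0'.1)
    obtain ⟨m, hm⟩ := Circle.exp_eq_exp.1 (Circle.coe_injective (e1.symm.trans e2))
    obtain rfl := eq_of_mem_Ico_two_pi (hn.1 h0.1) (hn'.1 h0'.1) hm
    rw [H.image_eq_Ioi h0.1 h0.2, H'.image_eq_Ioi h0'.1 h0'.2, hm]
    simp
  · rw [H.isType2_iff_image_eq_univ] at h0
    rw [H'.isType2_iff_image_eq_univ] at h0'
    rw [h0, h0']

lemma exists_add_int_mul_two_pi_mem_Ico (x : ℝ) :
    ∃ m : ℤ, x + m * (2 * Real.pi) ∈ Ico 0 (2 * Real.pi) := by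
  refine ⟨-toIcoDiv Real.two_pi_pos 0 x, ?_⟩
  have := toIcoMod_mem_Ico Real.two_pi_pos 0 x
  rw [toIcoMod, zsmul_eq_mul, zero_add] at this
  push_cast
  rwa [neg_mul, ← sub_eq_add_neg]

lemma bddBelow_image_add_const {D : Set ℝ} {c : ℝ} :
    BddBelow ((fun u => u + c) '' D) ↔ BddBelow D :=
  (OrderIso.addRight c).bddBelow_image

lemma bddAbove_image_add_const {D : Set ℝ} {c : ℝ} :
    BddAbove ((fun u => u + c) '' D) ↔ BddAbove D :=
  (OrderIso.addRight c).bddAbove_image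

lemma csInf_image_add_const {D : Set ℝ} (hne : D.Nonempty) (hb : BddBelow D) (c : ℝ) :
    sInf ((fun u => u + c) '' D) = sInf D + c :=
  ((OrderIso.addRight c).map_csInf' hne hb).symm

lemma csSup_image_add_const {D : Set ℝ} (hne : D.Nonempty) (hb : BddAbove D) (c : ℝ) :
    sSup ((fun u => u + c) '' D) = sSup D + c :=
  ((OrderIso.addRight c).map_csSup' hne hb).symm

lemma exists_isNormalised_image {D : Set ℝ} (hne : D.Nonempty) :
    ∃ m : ℤ, IsNormalised ((fun u => u + m * (2 * Real.pi)) '' D) := by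
  by_cases h1 : BddBelow D
  · obtain ⟨m, hm⟩ := exists_add_int_mul_two_pi_mem_Ico (sInf D)
    refine ⟨m, fun _ => ?_, fun h => absurd (bddBelow_image_add_const.2 h1) h⟩
    rwa [csInf_image_add_const hne h1]
  · obtain ⟨m, hm⟩ := exists_add_int_mul_two_pi_mem_Ico (sSup D)
    refine ⟨m, fun h => absurd (bddBelow_image_add_const.1 h) h1, fun _ h => ?_⟩
    rwa [csSup_image_add_const hne (bddAbove_image_add_const.1 h)]

/-- Normalised sets that are translates by a multiple of `2π` are equal or unbounded on both
sides. -/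
lemma IsNormalised.eq_zero_of_translate {D : Set ℝ} {m : ℤ} (hne : D.Nonempty)
    (hD : IsNormalised D) (hD' : IsNormalised ((fun u => u + m * (2 * Real.pi)) '' D)) :
    m = 0 ∨ ¬ BddBelow D ∧ ¬ BddAbove D := by
  by_cases h1 : BddBelow D
  · left
    exact eq_of_mem_Ico_two_pi (hD'.1 (bddBelow_image_add_const.2 h1)) (hD.1 h1)
      (csInf_image_add_const hne h1 _)
  · by_cases h2 : BddAbove D
    · left
      exact eq_of_mem_Ico_two_pi (hD'.2 (fun h => h1 (bddBelow_image_add_const.1 h))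
        (bddAbove_image_add_const.2 h2)) (hD.2 h1 h2) (csSup_image_add_const hne h2 _)
    · exact Or.inr ⟨h1, h2⟩

lemma IsArgLift.exists_isNormalised {B : ℂ → ℂ} {h : ℝ → ℝ} {α β : ℝ} (H : IsArgLift B h α β) :
    ∃ h', IsArgLift B h' α β ∧ IsNormalised (h' '' Ioo α β) := by
  obtain ⟨m, hm⟩ := exists_isNormalised_image H.nonempty
  refine ⟨fun t => h t + m * (2 * Real.pi), ⟨H.lt, H.continuousOn.add continuousOn_const,
    fun s hs t ht hst => by simpa using H.strictMonoOn hs ht hst, fun t ht => ?_⟩, ?_⟩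
  · rw [H.eq_exp t ht, Circle.exp_eq_exp.2 ⟨m, rfl⟩]
  · rwa [image_image] at hm

/-! ### The arcs lifted to the real line. -/

namespace IsCyclicEnumeration

variable {S : Set Circle} {n : ℕ} {θ : ℤ → ℝ} (hθ : IsCyclicEnumeration S n θ)
include hθ

lemma add_mul_period (j m : ℤ) : θ (j + n * m) = θ j + m * (2 * Real.pi) := by
  induction m using Int.induction_on with
  | zero => simp
  | succ i ih =>
    have := hθ.add_period (j + n * i)
    rw [show j + n * ((i : ℤ) + 1) = j + n * i + n by ring, this, ih]
    push_cast; ring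
  | pred i ih =>
    have := hθ.add_period (j + n * (-(i : ℤ) - 1))
    rw [show j + n * (-(i : ℤ) - 1) + n = j + n * (-(i : ℤ)) by ring, ih] at this
    push_cast at this ⊢; linarith

lemma exists_mem_Ico (t : ℝ) : ∃ j, t ∈ Ico (θ j) (θ (j + 1)) := by
  have hpi := Real.two_pi_pos
  obtain ⟨m, hm⟩ := exists_add_int_mul_two_pi_mem_Ico (t - θ 0)
  have h1 : θ (0 + n * (-m)) ≤ t := by
    rw [hθ.add_mul_period]; push_cast; linarith [hm.1]
  have h2 : t < θ (0 + n * (-m + 1)) := by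
    rw [hθ.add_mul_period]; push_cast; linarith [hm.2]
  obtain ⟨j, hj, hmax⟩ := Int.exists_greatest_of_bdd (P := fun z => θ z ≤ t)
    ⟨_, fun z hz => (hθ.strictMono.lt_iff_lt.1 (hz.trans_lt h2)).le⟩ ⟨_, h1⟩
  refine ⟨j, hj, not_le.1 fun hle => ?_⟩
  have := hmax _ hle
  omega

lemma eq_of_mem_Ico {t : ℝ} {i j : ℤ} (hi : t ∈ Ico (θ i) (θ (i + 1)))
    (hj : t ∈ Ico (θ j) (θ (j + 1))) : i = j := by
  have h1 := hθ.strictMono.lt_iff_lt.1 (hi.1.trans_lt hj.2)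
  have h2 := hθ.strictMono.lt_iff_lt.1 (hj.1.trans_lt hi.2)
  omega

lemma eq_or_mem_Ioo (t : ℝ) : ∃ j, t = θ j ∨ t ∈ Ioo (θ j) (θ (j + 1)) := by
  obtain ⟨j, hj⟩ := hθ.exists_mem_Ico t
  rcases hj.1.eq_or_lt with h | h
  exacts [⟨j, Or.inl h.symm⟩, ⟨j, Or.inr ⟨h, hj.2⟩⟩]

lemma notMem_Ioo (i j : ℤ) : θ i ∉ Ioo (θ j) (θ (j + 1)) := by
  rintro ⟨h1, h2⟩
  have := hθ.strictMono.lt_iff_lt.1 h1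
  have := hθ.strictMono.lt_iff_lt.1 h2
  omega

lemma exp_mem_iff {t : ℝ} : Circle.exp t ∈ S ↔ ∃ j, t = θ j := by
  rw [← hθ.range_eq]
  constructor
  · rintro ⟨j, hj⟩
    obtain ⟨m, hm⟩ := Circle.exp_eq_exp.1 hj.symm
    exact ⟨j + n * m, by rw [hθ.add_mul_period, hm]⟩
  · rintro ⟨j, rfl⟩
    exact ⟨j, rfl⟩

lemma exp_notMem {t : ℝ} {j : ℤ} (ht : t ∈ Ioo (θ j) (θ (j + 1))) : Circle.exp t ∉ S := by
  rw [hθ.exp_mem_iff]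
  rintro ⟨i, rfl⟩
  exact hθ.notMem_Ioo i j ht

lemma add_mem_Ioo_iff {t : ℝ} {j m : ℤ} :
    t + m * (2 * Real.pi) ∈ Ioo (θ (j + n * m)) (θ (j + n * m + 1)) ↔
      t ∈ Ioo (θ j) (θ (j + 1)) := by
  rw [show j + n * m + 1 = j + 1 + n * m by ring, hθ.add_mul_period, hθ.add_mul_period]
  simp [mem_Ioo]

end IsCyclicEnumeration

/-! ### A periodic normalised argument on all arcs. -/

/-- A `2π`-periodic function that is, on every arc, a normalised argument of the boundary
values. -/
structure IsPeriodicArg (B : ℂ → ℂ) (θ : ℤ → ℝ) (H : ℝ → ℝ) : Prop where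
  isArgLift : ∀ j : ℤ, IsArgLift B H (θ j) (θ (j + 1))
  isNormalised : ∀ j : ℤ, IsNormalised (H '' Ioo (θ j) (θ (j + 1)))
  add_two_pi : ∀ t, H (t + 2 * Real.pi) = H t

/-- Only the arguments chosen on arcs with index `j % n` are used, and they are transported by
periods: normalisation says nothing about type $2$ arcs, so independent choices need not be
periodic. At the singularities the value of `H` has no meaning. -/
lemma IsBlaschkeProduct.exists_isPeriodicArg {B : ℂ → ℂ} (hB : IsBlaschkeProduct B) {n : ℕ}
    (hn : 0 < n) {θ : ℤ → ℝ} (hθ : IsCyclicEnumeration (singularSet B) n θ) :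
    ∃ H, IsPeriodicArg B θ H := by
  have hne : (singularSet B).Nonempty := by
    rw [← hθ.range_eq]; exact range_nonempty _
  have hex : ∀ j : ℤ, ∃ h, IsArgLift B h (θ j) (θ (j + 1)) ∧
      IsNormalised (h '' Ioo (θ j) (θ (j + 1))) := by
    intro j
    obtain ⟨h, h1, h2, h3⟩ := hB.exists_strictMonoOn_lift hne
      (fun t ht => hθ.exp_notMem (j := j) ht)
    exact IsArgLift.exists_isNormalised ⟨hθ.strictMono (lt_add_one j), h1, h2, h3⟩
  choose h hh hN using hex
  choose idx hidx using hθ.exists_mem_Ico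
  set H : ℝ → ℝ := fun t => h (idx t % n) (t + (-(idx t / n) : ℤ) * (2 * Real.pi)) with hH
  have hidx_eq : ∀ {j : ℤ} {t : ℝ}, t ∈ Ioo (θ j) (θ (j + 1)) → idx t = j := fun ht =>
    hθ.eq_of_mem_Ico (hidx _) (Ioo_subset_Ico_self ht)
  have hdm : ∀ j : ℤ, j % n = j + n * (-(j / n)) := fun j => by
    have := Int.emod_add_mul_ediv j n
    linarith
  have hmem : ∀ {j : ℤ} {t : ℝ}, t + (-(j / n) : ℤ) * (2 * Real.pi) ∈
      Ioo (θ (j % n)) (θ (j % n + 1)) ↔ t ∈ Ioo (θ j) (θ (j + 1)) := fun {j t} => by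
    rw [hdm j]; exact hθ.add_mem_Ioo_iff
  have hEq : ∀ j : ℤ, EqOn H (fun t => h (j % n) (t + (-(j / n) : ℤ) * (2 * Real.pi)))
      (Ioo (θ j) (θ (j + 1))) := by
    intro j t ht
    simp only [hH, hidx_eq ht]
  refine ⟨H, fun j => ⟨hθ.strictMono (lt_add_one j), ?_, ?_, ?_⟩, fun j => ?_, fun t => ?_⟩
  · refine ContinuousOn.congr ?_ (hEq j)
    exact (hh (j % n)).continuousOn.comp (by fun_prop) fun t ht => hmem.2 ht
  · intro s hs t ht hst
    rw [hEq j hs, hEq j ht]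
    exact (hh (j % n)).strictMonoOn (hmem.2 hs) (hmem.2 ht) (by linarith)
  · intro t ht
    rw [hEq j ht, ← (hh (j % n)).eq_exp _ (hmem.2 ht), Circle.exp_eq_exp.2 ⟨_, rfl⟩]
  · have : H '' Ioo (θ j) (θ (j + 1)) = h (j % n) '' Ioo (θ (j % n)) (θ (j % n + 1)) := by
      rw [(hEq j).image_eq]
      ext u
      constructor
      · rintro ⟨t, ht, rfl⟩
        exact ⟨_, hmem.2 ht, rfl⟩
      · rintro ⟨t, ht, rfl⟩
        refine ⟨t + (j / n : ℤ) * (2 * Real.pi), hmem.1 ?_, ?_⟩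
        · push_cast; convert ht using 1; ring
        · simp only; congr 1; push_cast; ring
    rw [this]
    exact hN _
  · have hi : idx (t + 2 * Real.pi) = idx t + n := by
      refine hθ.eq_of_mem_Ico (hidx _) ?_
      rw [show idx t + (n : ℤ) + 1 = idx t + 1 + n by ring, hθ.add_period, hθ.add_period]
      exact ⟨by linarith [(hidx t).1], by linarith [(hidx t).2]⟩
    have hn' : (n : ℤ) ≠ 0 := by exact_mod_cast hn.ne'
    simp only [hH, hi]
    rw [Int.add_emod_right, Int.add_ediv_of_dvd_right (dvd_refl _), Int.ediv_self hn']
    congr 1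
    push_cast
    ring

namespace IsPeriodicArg

variable {B : ℂ → ℂ} {n : ℕ} {θ : ℤ → ℝ} {H : ℝ → ℝ} (hH : IsPeriodicArg B θ H)
include hH

lemma add_mul_two_pi (t : ℝ) (m : ℤ) : H (t + m * (2 * Real.pi)) = H t := by
  have : Function.Periodic H (2 * Real.pi) := hH.add_two_pi
  exact this.int_mul m t

lemma image_add_mul {S : Set Circle} (hθ : IsCyclicEnumeration S n θ) (j m : ℤ) :
    H '' Ioo (θ (j + n * m)) (θ (j + n * m + 1)) = H '' Ioo (θ j) (θ (j + 1)) := by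
  ext u
  constructor
  · rintro ⟨t, ht, rfl⟩
    refine ⟨t + (-m : ℤ) * (2 * Real.pi), ?_, hH.add_mul_two_pi _ _⟩
    rw [← hθ.add_mem_Ioo_iff (m := m)]
    convert ht using 1
    push_cast; ring
  · rintro ⟨t, ht, rfl⟩
    exact ⟨_, hθ.add_mem_Ioo_iff.2 ht, hH.add_mul_two_pi t m⟩

lemma image_congr {S : Set Circle} (hθ : IsCyclicEnumeration S n θ) {i j : ℤ}
    (hij : (i : ZMod n) = j) :
    H '' Ioo (θ i) (θ (i + 1)) = H '' Ioo (θ j) (θ (j + 1)) := by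
  obtain ⟨m, hm⟩ := (ZMod.intCast_eq_intCast_iff_dvd_sub i j n).1 hij
  obtain rfl : j = i + n * m := by linarith
  rw [hH.image_add_mul hθ]

end IsPeriodicArg

/-! ### Arc maps on the line. -/

/-- `X` is the lift to the line of a map of the circle that sends the arc `I_j` to `I_(j + s)` and
there adds `2π c_(j + s)` to the argument of the boundary value. -/
structure IsArcMap {n : ℕ} (θ : ℤ → ℝ) (H : ℝ → ℝ) (s : ℤ) (c : ZMod n → ℤ) (X : ℝ → ℝ) :
    Prop where
  apply_endpoint : ∀ j, X (θ j) = θ (j + s)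
  mem_Ioo : ∀ {j t}, t ∈ Ioo (θ j) (θ (j + 1)) → X t ∈ Ioo (θ (j + s)) (θ (j + s + 1))
  arg_apply : ∀ {j t}, t ∈ Ioo (θ j) (θ (j + 1)) →
    H (X t) = H t + c ((j + s : ℤ) : ZMod n) * (2 * Real.pi)

/-- The pair of a rotation of the arcs by `s` and shifts `c` is compatible with the images of the
arcs. -/
structure IsAdmissible {n : ℕ} (θ : ℤ → ℝ) (H : ℝ → ℝ) (s : ℤ) (c : ZMod n → ℤ) : Prop where
  image_eq : ∀ j, H '' Ioo (θ (j + s)) (θ (j + s + 1)) = H '' Ioo (θ j) (θ (j + 1))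
  image_eq_univ : ∀ j : ℤ, c (j : ZMod n) ≠ 0 → H '' Ioo (θ j) (θ (j + 1)) = univ

section ArcMap

variable {B : ℂ → ℂ} {S : Set Circle} {n : ℕ} {θ : ℤ → ℝ} {H : ℝ → ℝ}
  (hθ : IsCyclicEnumeration S n θ) (hH : IsPeriodicArg B θ H) {s s' : ℤ} {c c' : ZMod n → ℤ}
  {X X' : ℝ → ℝ}

include hθ hH in
-- As `H` is injective on the target arc, the pair $(s,c)$ determines the map. Identities between
-- maps thus reduce to identities between pairs.
lemma IsArcMap.eq (hX : IsArcMap θ H s c X) (hX' : IsArcMap θ H s c X') : X = X' := by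
  funext t
  obtain ⟨j, rfl | ht⟩ := hθ.eq_or_mem_Ioo t
  · rw [hX.apply_endpoint, hX'.apply_endpoint]
  · exact (hH.isArgLift (j + s)).strictMonoOn.injOn (hX.mem_Ioo ht) (hX'.mem_Ioo ht)
      (by rw [hX.arg_apply ht, hX'.arg_apply ht])

/-- Shifts are indexed by the target arc, so the inner family appears translated by `s`, as in a
semidirect product. -/
lemma IsArcMap.comp (hX : IsArcMap θ H s c X) (hX' : IsArcMap θ H s' c' X') :
    IsArcMap θ H (s + s') (fun m => c m + c' (m - s)) (X ∘ X') where
  apply_endpoint j := by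
    rw [Function.comp_apply, hX'.apply_endpoint, hX.apply_endpoint, add_assoc, add_comm s']
  mem_Ioo ht := by
    have := hX.mem_Ioo (hX'.mem_Ioo ht)
    rwa [add_assoc _ s', add_comm s'] at this
  arg_apply ht := by
    rw [Function.comp_apply, hX.arg_apply (hX'.mem_Ioo ht), hX'.arg_apply ht]
    push_cast
    ring_nf

include hθ hH in
lemma isArcMap_add_mul_two_pi (m : ℤ) :
    IsArcMap θ H (n * m) (0 : ZMod n → ℤ) (fun t => t + m * (2 * Real.pi)) where
  apply_endpoint j := (hθ.add_mul_period j m).symm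
  mem_Ioo ht := hθ.add_mem_Ioo_iff.2 ht
  arg_apply _ := by simp [hH.add_mul_two_pi]

lemma isArcMap_id : IsArcMap θ H 0 (0 : ZMod n → ℤ) id where
  apply_endpoint j := by simp
  mem_Ioo ht := by simpa using ht
  arg_apply ht := by simp

include hθ hH in
-- Translation by $2\pi m$ is the arc map of the pair $(nm,0)$. Composed with `X` on either side it
-- gives the same pair, because `c` is indexed modulo `n`.
lemma IsArcMap.apply_add_mul_two_pi (hX : IsArcMap θ H s c X) (t : ℝ) (m : ℤ) :
    X (t + m * (2 * Real.pi)) = X t + m * (2 * Real.pi) := by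
  have h1 := hX.comp (isArcMap_add_mul_two_pi hθ hH m)
  have h2 := (isArcMap_add_mul_two_pi hθ hH m).comp hX
  simp only [Pi.zero_apply, zero_add, add_zero] at h1 h2
  rw [add_comm] at h2
  have h3 : (fun a => c (a - ((n * m : ℤ) : ZMod n))) = c := by
    funext a
    simp
  rw [h3] at h2
  exact congrFun (h1.eq hθ hH h2) t

include hθ in
-- On each arc the map is the inverse of `H` on the target arc applied to $H+2\pi c$; admissibility
-- puts this value in the range of `H` there.
lemma IsAdmissible.exists_isArcMap (h : IsAdmissible θ H s c) : ∃ X, IsArcMap θ H s c X := by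
  have hex : ∀ t, ∃ y, ∀ j, (t = θ j → y = θ (j + s)) ∧ (t ∈ Ioo (θ j) (θ (j + 1)) →
      y ∈ Ioo (θ (j + s)) (θ (j + s + 1)) ∧
        H y = H t + c ((j + s : ℤ) : ZMod n) * (2 * Real.pi)) := by
    intro t
    obtain ⟨j, rfl | ht⟩ := hθ.eq_or_mem_Ioo t
    · refine ⟨θ (j + s), fun i => ⟨fun hi => ?_, fun hi => absurd hi (hθ.notMem_Ioo j i)⟩⟩
      rw [hθ.strictMono.injective hi]
    · have hmem : H t + c ((j + s : ℤ) : ZMod n) * (2 * Real.pi) ∈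
          H '' Ioo (θ (j + s)) (θ (j + s + 1)) := by
        by_cases h0 : c ((j + s : ℤ) : ZMod n) = 0
        · rw [h0, h.image_eq]
          simpa using mem_image_of_mem H ht
        · rw [h.image_eq_univ _ h0]
          trivial
      obtain ⟨y, hy, hyH⟩ := hmem
      refine ⟨y, fun i => ⟨?_, fun hi => ?_⟩⟩
      · rintro rfl
        exact absurd ht (hθ.notMem_Ioo i j)
      · obtain rfl := hθ.eq_of_mem_Ico (Ioo_subset_Ico_self hi) (Ioo_subset_Ico_self ht)
        exact ⟨hy, hyH⟩
  choose X hX using hex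
  exact ⟨X, fun j => (hX _ j).1 rfl, fun {j t} ht => ((hX t j).2 ht).1,
    fun {j t} ht => ((hX t j).2 ht).2⟩

lemma IsAdmissible.inv (h : IsAdmissible θ H s c) :
    IsAdmissible θ H (-s) (fun m : ZMod n => -c (m + (s : ZMod n))) where
  image_eq j := by
    have := h.image_eq (j + -s)
    rw [neg_add_cancel_right] at this
    exact this.symm
  image_eq_univ j hj := by
    rw [← h.image_eq]
    exact h.image_eq_univ _ (by push_cast; exact neg_ne_zero.1 hj)

include hθ hH in
lemma IsArcMap.exists_inverse (h : IsAdmissible θ H s c) (hX : IsArcMap θ H s c X) :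
    ∃ Y, IsArcMap θ H (-s) (fun m : ZMod n => -c (m + (s : ZMod n))) Y ∧ X ∘ Y = id ∧ Y ∘ X = id := by
  obtain ⟨Y, hY⟩ := h.inv.exists_isArcMap hθ
  refine ⟨Y, hY, ?_, ?_⟩
  · have := hX.comp hY
    simp only [add_neg_cancel, sub_add_cancel] at this
    exact this.eq hθ hH isArcMap_id
  · have := hY.comp hX
    simp only [neg_add_cancel, Int.cast_neg, sub_neg_eq_add] at this
    exact this.eq hθ hH isArcMap_id

include hθ hH in
lemma IsArcMap.strictMono (hX : IsArcMap θ H s c X) : StrictMono X := by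
  have hmem : ∀ {t j}, t ∈ Ico (θ j) (θ (j + 1)) → X t ∈ Ico (θ (j + s)) (θ (j + s + 1)) := by
    intro t j ht
    rcases ht.1.eq_or_lt with rfl | h
    · rw [hX.apply_endpoint]
      exact ⟨le_rfl, hθ.strictMono (lt_add_one _)⟩
    · exact Ioo_subset_Ico_self (hX.mem_Ioo ⟨h, ht.2⟩)
  intro t u htu
  obtain ⟨i, hi⟩ := hθ.exists_mem_Ico t
  obtain ⟨j, hj⟩ := hθ.exists_mem_Ico u
  have hij : i < j + 1 := hθ.strictMono.lt_iff_lt.1 (hi.1.trans_lt (htu.trans hj.2))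
  rcases (Int.lt_add_one_iff.1 hij).eq_or_lt with rfl | hlt
  · have hu : u ∈ Ioo (θ i) (θ (i + 1)) := ⟨hi.1.trans_lt htu, hj.2⟩
    rcases hi.1.eq_or_lt with rfl | h
    · rw [hX.apply_endpoint]
      exact (hX.mem_Ioo hu).1
    · have ht : t ∈ Ioo (θ i) (θ (i + 1)) := ⟨h, hi.2⟩
      rw [← (hH.isArgLift (i + s)).strictMonoOn.lt_iff_lt (hX.mem_Ioo ht) (hX.mem_Ioo hu),
        hX.arg_apply ht, hX.arg_apply hu, add_lt_add_iff_right]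
      exact (hH.isArgLift i).strictMonoOn ht hu htu
  · refine ((hmem hi).2.trans_le (hθ.strictMono.monotone ?_)).trans_le (hmem hj).1
    omega

include hθ hH in
-- A monotone surjection of the line is continuous, so the endpoints need no separate check.
lemma IsArcMap.continuous (h : IsAdmissible θ H s c) (hX : IsArcMap θ H s c X) :
    Continuous X := by
  obtain ⟨Y, -, hXY, -⟩ := hX.exists_inverse hθ hH h
  exact (hX.strictMono hθ hH).monotone.continuous_of_surjective
    fun u => ⟨Y u, congrFun hXY u⟩

end ArcMap

/-! ### Maps of the circle induced by arc maps. -/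

lemma circleExp_surjective : Function.Surjective fun t : ℝ => Circle.exp t :=
  fun p => ⟨_, Circle.exp_arg p⟩

/-- A map of the circle with a lift that moves the arcs by `s` and shifts arguments by `c`. -/
def IsInducedBy {n : ℕ} (θ : ℤ → ℝ) (H : ℝ → ℝ) (s : ℤ) (c : ZMod n → ℤ)
    (x : Circle → Circle) : Prop :=
  ∃ X, IsArcMap θ H s c X ∧ ∀ t : ℝ, x (Circle.exp t) = Circle.exp (X t)

section

variable {B : ℂ → ℂ} {n : ℕ} {θ : ℤ → ℝ} {H : ℝ → ℝ}
  (hθ : IsCyclicEnumeration (singularSet B) n θ) (hH : IsPeriodicArg B θ H) {s s' : ℤ}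
  {c c' : ZMod n → ℤ} {x x' : Circle → Circle}

include hθ hH

lemma IsInducedBy.eq (h : IsInducedBy θ H s c x) (h' : IsInducedBy θ H s c x') : x = x' := by
  obtain ⟨X, hX, hx⟩ := h
  obtain ⟨X', hX', hx'⟩ := h'
  funext p
  obtain ⟨t, rfl⟩ := circleExp_surjective p
  simp only [hx, hx', hX.eq hθ hH hX']

omit hθ hH in
lemma IsInducedBy.comp (h : IsInducedBy θ H s c x) (h' : IsInducedBy θ H s' c' x') :
    IsInducedBy θ H (s + s') (fun m => c m + c' (m - s)) (x ∘ x') := by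
  obtain ⟨X, hX, hx⟩ := h
  obtain ⟨X', hX', hx'⟩ := h'
  exact ⟨_, hX.comp hX', fun t => by simp [hx', hx]⟩

/-- Changing `s` by $nm$ composes the lift with the translation by $2\pi m$, invisible on the
circle. -/
lemma IsInducedBy.congr (h : IsInducedBy θ H s c x) (hs : (s : ZMod n) = s') :
    IsInducedBy θ H s' c x := by
  obtain ⟨X, hX, hx⟩ := h
  obtain ⟨m, hm⟩ := (ZMod.intCast_eq_intCast_iff_dvd_sub s s' n).1 hs
  obtain rfl : s' = n * m + s := by linarith
  refine ⟨(fun t => t + m * (2 * Real.pi)) ∘ X, ?_, fun t => ?_⟩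
  · convert (isArcMap_add_mul_two_pi hθ hH m).comp hX using 1
    · funext a
      simp
  · rw [hx, Function.comp_apply, Circle.exp_eq_exp.2 ⟨m, rfl⟩]

lemma IsAdmissible.exists_isInducedBy (h : IsAdmissible θ H s c) :
    ∃ x, IsInducedBy θ H s c x := by
  obtain ⟨X, hX⟩ := h.exists_isArcMap hθ
  refine ⟨fun p => Circle.exp (X (Complex.arg p)), X, hX, fun t => ?_⟩
  obtain ⟨m, hm⟩ := Circle.exp_eq_exp.1 (Circle.exp_arg (Circle.exp t))
  simp only
  rw [hm, hX.apply_add_mul_two_pi hθ hH, Circle.exp_eq_exp.2 ⟨m, rfl⟩]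

/-- The rotation is read off from the image of one singularity, and each shift from the change of
`H` at one point of an arc. -/
lemma IsInducedBy.injective (hn : 0 < n) (h : IsInducedBy θ H s c x)
    (h' : IsInducedBy θ H s' c' x) : (s : ZMod n) = s' ∧ c = c' := by
  have hn' : (n : ℤ) ≠ 0 := by exact_mod_cast hn.ne'
  have hs : (s : ZMod n) = s' := by
    obtain ⟨X, hX, hx⟩ := h
    obtain ⟨X', hX', hx'⟩ := h'
    have h0 := (hx (θ 0)).symm.trans (hx' (θ 0))
    rw [hX.apply_endpoint, hX'.apply_endpoint, zero_add, zero_add] at h0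
    obtain ⟨m, hm⟩ := Circle.exp_eq_exp.1 h0
    rw [← hθ.add_mul_period] at hm
    rw [hθ.strictMono.injective hm]
    simp
  refine ⟨hs, ?_⟩
  obtain ⟨X, hX, hx⟩ := h.congr hθ hH hs
  obtain ⟨X', hX', hx'⟩ := h'
  funext a
  obtain ⟨j, rfl⟩ := ZMod.intCast_surjective a
  obtain ⟨t, ht⟩ := nonempty_Ioo.2 (hθ.strictMono (lt_add_one (j - s')))
  have h1 := hX.mem_Ioo ht
  have h2 := hX'.mem_Ioo ht
  obtain ⟨m, hm⟩ := Circle.exp_eq_exp.1 ((hx t).symm.trans (hx' t))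
  have h3 := hθ.add_mem_Ioo_iff (m := m).2 h2
  rw [← hm] at h3
  have h4 := hθ.eq_of_mem_Ico (Ioo_subset_Ico_self h1) (Ioo_subset_Ico_self h3)
  have hm0 : m = 0 := by
    have : (n : ℤ) * m = 0 := by linarith
    exact (mul_eq_zero.1 this).resolve_left hn'
  have h5 := hX.arg_apply ht
  have h6 := hX'.arg_apply ht
  rw [hm, hm0] at h5
  simp only [Int.cast_zero, zero_mul, add_zero, sub_add_cancel] at h5 h6
  have h7 := mul_right_cancel₀ Real.two_pi_pos.ne' (add_left_cancel (h5.symm.trans h6))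
  exact_mod_cast h7

lemma IsInducedBy.mem_invariants (ha : IsAdmissible θ H s c) (h : IsInducedBy θ H s c x) :
    (x : Function.End Circle) ∈ invariants B := by
  obtain ⟨X, hX, hx⟩ := h
  refine ⟨?_, fun p hp => ?_, fun p hp => ?_, fun p hp => ?_⟩
  · have hq : IsQuotientMap fun t : ℝ => Circle.exp t :=
      Circle.isCoveringMap_exp.isQuotientMap circleExp_surjective
    rw [hq.continuous_iff]
    have : (x ∘ fun t : ℝ => Circle.exp t) = fun t => Circle.exp (X t) := funext hx
    rw [this]
    exact Circle.exp.continuous.comp (hX.continuous hθ hH ha)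
  · obtain ⟨t, rfl⟩ := circleExp_surjective p
    obtain ⟨j, rfl⟩ := hθ.exp_mem_iff.1 hp
    simp only [hx, hX.apply_endpoint]
    exact hθ.exp_mem_iff.2 ⟨_, rfl⟩
  · obtain ⟨t, rfl⟩ := circleExp_surjective p
    obtain ⟨j, rfl | ht⟩ := hθ.eq_or_mem_Ioo t
    · exact absurd (hθ.exp_mem_iff.2 ⟨j, rfl⟩) hp
    · simp only [hx]
      exact hθ.exp_notMem (hX.mem_Ioo ht)
  · obtain ⟨t, rfl⟩ := circleExp_surjective p
    obtain ⟨j, rfl | ht⟩ := hθ.eq_or_mem_Ioo t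
    · exact absurd (hθ.exp_mem_iff.2 ⟨j, rfl⟩) hp
    · simp only [hx]
      rw [(hH.isArgLift _).eq_exp _ (hX.mem_Ioo ht), (hH.isArgLift _).eq_exp _ ht,
        Circle.exp_eq_exp.2 ⟨_, hX.arg_apply ht⟩]

end

/-! ### Every invariant is induced by an arc map. -/

/-- Discreteness of $2\pi\mathbb Z$; applied to the values of `H ∘ X - H` on an arc. -/
lemma subsingleton_of_ordConnected_of_subset_int_mul {E : Set ℝ} (hE : E.OrdConnected)
    (h : ∀ u ∈ E, ∃ m : ℤ, u = m * (2 * Real.pi)) : E.Subsingleton := by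
  have hpi := Real.two_pi_pos
  have key : ∀ u ∈ E, ∀ v ∈ E, ¬ u < v := by
    intro u hu v hv huv
    obtain ⟨k, rfl⟩ := h u hu
    obtain ⟨l, rfl⟩ := h v hv
    have hkl : k + 1 ≤ l := by
      have := (mul_lt_mul_iff_left₀ hpi).1 huv
      exact_mod_cast this
    have hkl' : (k : ℝ) + 1 ≤ l := by exact_mod_cast hkl
    obtain ⟨m, hm⟩ := h (((k : ℝ) + 1 / 2) * (2 * Real.pi))
      (hE.out hu hv ⟨by nlinarith, by nlinarith⟩)
    have h1 := mul_right_cancel₀ hpi.ne' hm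
    have h2 : 2 * k + 1 = 2 * m := by
      have : 2 * (k : ℝ) + 1 = 2 * m := by linarith
      exact_mod_cast this
    omega
  intro u hu v hv
  exact le_antisymm (not_lt.1 (key v hv u hu)) (not_lt.1 (key u hu v hv))

lemma exists_circleExp_lift {x : Circle → Circle} (hx : Continuous x) :
    ∃ X : ℝ → ℝ, Continuous X ∧ ∀ t : ℝ, x (Circle.exp t) = Circle.exp (X t) := by
  obtain ⟨e₀, he₀⟩ := circleExp_surjective (x (Circle.exp 0))
  obtain ⟨F, ⟨-, hF⟩, -⟩ := Circle.isCoveringMap_exp.existsUnique_continuousMap_lifts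
    ⟨fun t : ℝ => x (Circle.exp t), hx.comp Circle.exp.continuous⟩ 0 e₀ he₀
  exact ⟨F, F.continuous, fun t => (congrFun hF t).symm⟩

section

variable {B : ℂ → ℂ} {n : ℕ} {θ : ℤ → ℝ} {H : ℝ → ℝ}
  (hθ : IsCyclicEnumeration (singularSet B) n θ) (hH : IsPeriodicArg B θ H) {x : Circle → Circle}
  (hx : (x : Function.End Circle) ∈ invariants B) {X : ℝ → ℝ} (hXc : Continuous X)
  (hX : ∀ t : ℝ, x (Circle.exp t) = Circle.exp (X t))

include hθ hH hx hXc hX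

/-- On a single arc, the lift of an invariant maps onto some arc and shifts the argument of the
boundary values by a constant. -/
lemma exists_arc_of_mem_invariants (j : ℤ) :
    ∃ m k : ℤ, X (θ j) = θ m ∧ X (θ (j + 1)) = θ (m + 1) ∧
      ∀ t ∈ Ioo (θ j) (θ (j + 1)), X t ∈ Ioo (θ m) (θ (m + 1)) ∧
        H (X t) = H t + k * (2 * Real.pi) := by
  have hlt := hθ.strictMono (lt_add_one j)
  obtain ⟨-, hxs, hxr, hxB⟩ := hx
  have hend : ∀ i, ∃ l, X (θ i) = θ l := fun i => by
    rw [← hθ.exp_mem_iff, ← hX]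
    exact hxs _ (hθ.exp_mem_iff.2 ⟨i, rfl⟩)
  have hnot : ∀ t ∈ Ioo (θ j) (θ (j + 1)), ∀ l, X t ≠ θ l := fun t ht l hl => by
    have := hxr _ (hθ.exp_notMem ht)
    rw [hX, hl] at this
    exact this (hθ.exp_mem_iff.2 ⟨l, rfl⟩)
  obtain ⟨t₀, ht₀⟩ := nonempty_Ioo.2 hlt
  obtain ⟨m, hm | hm⟩ := hθ.eq_or_mem_Ioo (X t₀)
  · exact absurd hm (hnot t₀ ht₀ m)
  have hord : (X '' Ioo (θ j) (θ (j + 1))).OrdConnected :=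
    (isPreconnected_Ioo.image X hXc.continuousOn).ordConnected
  -- To leave the arc, `X` would have to pass through one of its endpoints, but regular points do
  -- not go to singularities.
  have hmem : ∀ t ∈ Ioo (θ j) (θ (j + 1)), X t ∈ Ioo (θ m) (θ (m + 1)) := by
    intro t ht
    by_contra hout
    rw [mem_Ioo, not_and_or, not_lt, not_lt] at hout
    rcases hout with h1 | h1
    · obtain ⟨u, hu, hu'⟩ := hord.out (mem_image_of_mem X ht) (mem_image_of_mem X ht₀)
        ⟨h1, hm.1.le⟩
      exact hnot u hu m hu'
    · obtain ⟨u, hu, hu'⟩ := hord.out (mem_image_of_mem X ht₀) (mem_image_of_mem X ht)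
        ⟨hm.2.le, h1⟩
      exact hnot u hu (m + 1) hu'
  set g : ℝ → ℝ := fun t => H (X t) - H t with hg
  have hgc : ContinuousOn g (Ioo (θ j) (θ (j + 1))) :=
    ((hH.isArgLift m).continuousOn.comp hXc.continuousOn hmem).sub (hH.isArgLift j).continuousOn
  have hgi : ∀ u ∈ g '' Ioo (θ j) (θ (j + 1)), ∃ k : ℤ, u = k * (2 * Real.pi) := by
    rintro _ ⟨t, ht, rfl⟩
    have h1 := hxB _ (hθ.exp_notMem ht)
    rw [hX, (hH.isArgLift m).eq_exp _ (hmem t ht), (hH.isArgLift j).eq_exp _ ht] at h1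
    obtain ⟨k, hk⟩ := Circle.exp_eq_exp.1 (Circle.coe_injective h1)
    exact ⟨k, by simp only [hg, hk]; ring⟩
  have hsub := subsingleton_of_ordConnected_of_subset_int_mul
    (isPreconnected_Ioo.image g hgc).ordConnected hgi
  obtain ⟨k, hk⟩ := hgi _ (mem_image_of_mem g ht₀)
  have harg : ∀ t ∈ Ioo (θ j) (θ (j + 1)), H (X t) = H t + k * (2 * Real.pi) := by
    intro t ht
    have := hsub (mem_image_of_mem g ht) (mem_image_of_mem g ht₀)
    rw [hk] at this
    simp only [hg] at this
    linarith
  have hmono : StrictMonoOn X (Ioo (θ j) (θ (j + 1))) := by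
    intro t ht u hu htu
    rw [← (hH.isArgLift m).strictMonoOn.lt_iff_lt (hmem t ht) (hmem u hu), harg t ht, harg u hu,
      add_lt_add_iff_right]
    exact (hH.isArgLift j).strictMonoOn ht hu htu
  refine ⟨m, k, ?_, ?_, fun t ht => ⟨hmem t ht, harg t ht⟩⟩
  -- The endpoint goes to some `θ l`, and monotonicity gives `θ m ≤ θ l < θ (m + 1)`.
  · obtain ⟨l, hl⟩ := hend j
    have hlim : Tendsto X (𝓝[>] θ j) (𝓝 (X (θ j))) :=
      (hXc.tendsto _).mono_left nhdsWithin_le_nhds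
    have h1 : θ m ≤ X (θ j) := by
      refine ge_of_tendsto hlim ?_
      filter_upwards [Ioo_mem_nhdsGT hlt] with t ht using (hmem t ht).1.le
    have h2 : X (θ j) ≤ X t₀ := by
      refine le_of_tendsto hlim ?_
      filter_upwards [Ioo_mem_nhdsGT ht₀.1] with t ht
      exact (hmono ⟨ht.1, ht.2.trans ht₀.2⟩ ht₀ ht.2).le
    rw [hl] at h1 h2 ⊢
    have h3 := hθ.strictMono.le_iff_le.1 h1
    have h4 := hθ.strictMono.lt_iff_lt.1 (h2.trans_lt hm.2)
    congr 1
    omega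
  · obtain ⟨l, hl⟩ := hend (j + 1)
    have hlim : Tendsto X (𝓝[<] θ (j + 1)) (𝓝 (X (θ (j + 1)))) :=
      (hXc.tendsto _).mono_left nhdsWithin_le_nhds
    have h1 : X (θ (j + 1)) ≤ θ (m + 1) := by
      refine le_of_tendsto hlim ?_
      filter_upwards [Ioo_mem_nhdsLT hlt] with t ht using (hmem t ht).2.le
    have h2 : X t₀ ≤ X (θ (j + 1)) := by
      refine ge_of_tendsto hlim ?_
      filter_upwards [Ioo_mem_nhdsLT ht₀.2] with t ht
      exact (hmono ht₀ ⟨ht₀.1.trans ht.1, ht.2⟩ ht.1).le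
    rw [hl] at h1 h2 ⊢
    have h3 := hθ.strictMono.le_iff_le.1 h1
    have h4 := hθ.strictMono.lt_iff_lt.1 (hm.1.trans_le h2)
    congr 1
    omega

end

section

variable {B : ℂ → ℂ} {n : ℕ} {θ : ℤ → ℝ} {H : ℝ → ℝ}
  (hθ : IsCyclicEnumeration (singularSet B) n θ) (hH : IsPeriodicArg B θ H) {x : Circle → Circle}

include hθ hH

/-- Every invariant is induced by an admissible pair. -/
lemma exists_isInducedBy_of_mem_invariants (hx : (x : Function.End Circle) ∈ invariants B) :
    ∃ (s : ℤ) (c : ZMod n → ℤ), IsAdmissible θ H s c ∧ IsInducedBy θ H s c x := by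
  obtain ⟨X, hXc, hX⟩ := exists_circleExp_lift hx.1
  choose m k hstart hend hmap using exists_arc_of_mem_invariants hθ hH hx hXc hX
  -- Consecutive arcs share an endpoint, so their images are consecutive.
  have hm1 : ∀ j, m (j + 1) = m j + 1 := fun j =>
    hθ.strictMono.injective ((hstart (j + 1)).symm.trans (hend j))
  have hm : ∀ j, m j = j + m 0 := by
    intro j
    induction j using Int.induction_on with
    | zero => simp
    | succ i ih => rw [hm1, ih]; ring
    | pred i ih =>
      have := hm1 (-(i : ℤ) - 1)
      rw [sub_add_cancel] at this
      linarith
  -- Over one period `X` changes by a multiple of $2\pi$, which `H` does not see.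
  have hk : ∀ {i j : ℤ}, (i : ZMod n) = j → k i = k j := by
    intro i j hij
    obtain ⟨q, hq⟩ := (ZMod.intCast_eq_intCast_iff_dvd_sub i j n).1 hij
    obtain rfl : j = i + n * q := by linarith
    obtain ⟨t, ht⟩ := nonempty_Ioo.2 (hθ.strictMono (lt_add_one i))
    have ht' := hθ.add_mem_Ioo_iff (m := q).2 ht
    have h1 := (hmap _ t ht).2
    have h2 := (hmap _ _ ht').2
    have h3 : Circle.exp (X (t + q * (2 * Real.pi))) = Circle.exp (X t) := by
      rw [← hX, ← hX, Circle.exp_eq_exp.2 ⟨q, rfl⟩]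
    obtain ⟨r, hr⟩ := Circle.exp_eq_exp.1 h3
    rw [hr, hH.add_mul_two_pi, hH.add_mul_two_pi, h1] at h2
    have h4 := mul_right_cancel₀ Real.two_pi_pos.ne' (add_left_cancel h2)
    exact_mod_cast h4
  -- Integer representatives of the residues, used to index the shifts by the target arc.
  obtain ⟨l, hl⟩ := (ZMod.intCast_surjective (n := n)).hasRightInverse
  have hc : ∀ j : ℤ, k (l ((j + m 0 : ℤ) : ZMod n) - m 0) = k j := fun j => hk (by
    rw [Int.cast_sub, hl]
    push_cast
    ring)
  have himage : ∀ j, H '' Ioo (θ (j + m 0)) (θ (j + m 0 + 1)) =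
      (fun u => u + k j * (2 * Real.pi)) '' (H '' Ioo (θ j) (θ (j + 1))) := by
    intro j
    rw [← hm j]
    ext u
    constructor
    · rintro ⟨t, ht, rfl⟩
      have hivt := intermediate_value_Ioo (hθ.strictMono (lt_add_one j)).le hXc.continuousOn
      rw [hstart, hend] at hivt
      obtain ⟨r, hr, rfl⟩ := hivt ht
      exact ⟨_, mem_image_of_mem H hr, ((hmap j r hr).2).symm⟩
    · rintro ⟨_, ⟨t, ht, rfl⟩, rfl⟩
      exact ⟨X t, (hmap j t ht).1, (hmap j t ht).2⟩
  -- Source and target ranges are both normalised and are translates of each other, so a nonzero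
  -- shift forces the whole line.
  have hdich : ∀ j, k j = 0 ∨ H '' Ioo (θ j) (θ (j + 1)) = univ := by
    intro j
    have hN := hH.isNormalised (j + m 0)
    rw [himage] at hN
    refine ((hH.isNormalised j).eq_zero_of_translate (hH.isArgLift j).nonempty hN).imp_right ?_
    exact fun h => (hH.isArgLift j).image_eq_univ h.1 h.2
  have heq : ∀ j, H '' Ioo (θ (j + m 0)) (θ (j + m 0 + 1)) = H '' Ioo (θ j) (θ (j + 1)) := by
    intro j
    rw [himage]
    rcases hdich j with h0 | h0
    · simp [h0]
    · rw [h0]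
      exact image_univ_of_surjective (Equiv.addRight _).surjective
  refine ⟨m 0, fun a => k (l a - m 0), ⟨heq, fun j hj => ?_⟩, X,
    ⟨fun j => by rw [hstart, hm], fun {j t} ht => ?_, fun {j t} ht => ?_⟩, hX⟩
  · have h1 := heq (j - m 0)
    rw [sub_add_cancel] at h1
    rw [h1]
    refine (hdich (j - m 0)).resolve_left ?_
    rw [← hc]
    simpa using hj
  · rw [← hm]
    exact (hmap j t ht).1
  · rw [hc]
    exact (hmap j t ht).2

end

/-! ### Homomorphisms out of $\mathbb Z^k$ and $\mathbb Z_d$. -/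

section PiInt

variable {ι M : Type*} [DecidableEq ι]

lemma ofAdd_single_eq_zpow (i : ι) (m : ℤ) :
    (Multiplicative.ofAdd (Pi.single i m) : Multiplicative (ι → ℤ)) =
      Multiplicative.ofAdd (Pi.single i 1) ^ m := by
  rw [← ofAdd_zsmul, ← Pi.single_smul]
  simp

lemma monoidHom_ext_of_single [Finite ι] [Group M] {f g : Multiplicative (ι → ℤ) →* M}
    (h : ∀ i, f (Multiplicative.ofAdd (Pi.single i 1)) =
      g (Multiplicative.ofAdd (Pi.single i 1))) : f = g := by
  set E := (MulEquiv.piMultiplicative fun _ : ι => ℤ).symm.toMonoidHom with hE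
  have key : f.comp E = g.comp E := by
    refine MonoidHom.pi_ext fun i x => ?_
    have hx : E (Pi.mulSingle i x) = Multiplicative.ofAdd (Pi.single i x.toAdd) := by
      rfl
    rw [MonoidHom.comp_apply, MonoidHom.comp_apply, hx, ofAdd_single_eq_zpow, map_zpow, map_zpow,
      h]
  exact MonoidHom.ext fun c =>
    DFunLike.congr_fun key (MulEquiv.piMultiplicative (fun _ : ι => ℤ) c)

lemma exists_monoidHom_of_commute [Fintype ι] [Group M] (x : ι → M)
    (hx : ∀ i j, Commute (x i) (x j)) :
    ∃ f : Multiplicative (ι → ℤ) →* M, ∀ i, f (Multiplicative.ofAdd (Pi.single i 1)) = x i := by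
  have hcomm : Pairwise fun i j => ∀ a b : Multiplicative ℤ,
      Commute (zpowersHom M (x i) a) (zpowersHom M (x j) b) := fun i j _ a b =>
    (hx i j).zpow_zpow _ _
  refine ⟨(MonoidHom.noncommPiCoprod (fun i => zpowersHom M (x i)) hcomm).comp
    (MulEquiv.piMultiplicative fun _ : ι => ℤ).toMonoidHom, fun i => ?_⟩
  have : (MulEquiv.piMultiplicative fun _ : ι => ℤ) (Multiplicative.ofAdd (Pi.single i 1)) =
      Pi.mulSingle i (Multiplicative.ofAdd 1) := by
    rfl
  rw [MonoidHom.comp_apply, MulEquiv.coe_toMonoidHom, this, MonoidHom.noncommPiCoprod_mulSingle]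
  simp

end PiInt

lemma exists_monoidHom_zmod {M : Type*} [Group M] {d : ℕ} (y : M) (hy : y ^ d = 1) :
    ∃ f : Multiplicative (ZMod d) →* M, f (Multiplicative.ofAdd 1) = y := by
  refine ⟨AddMonoidHom.toMultiplicativeLeft
    (ZMod.lift d ⟨zmultiplesHom (Additive M) (Additive.ofMul y), ?_⟩), ?_⟩
  · simp [← ofMul_pow, hy]
  · have := ZMod.lift_coe d (A := Additive M)
      ⟨zmultiplesHom (Additive M) (Additive.ofMul y), by simp [← ofMul_pow, hy]⟩ 1
    rw [Int.cast_one] at this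
    change Additive.toMul _ = y
    rw [toAdd_ofAdd, this]
    simp

lemma exists_eq_ofAdd_one_pow {d : ℕ} [NeZero d] (a : Multiplicative (ZMod d)) :
    ∃ m : ℕ, a = Multiplicative.ofAdd 1 ^ m :=
  ⟨(Multiplicative.toAdd a).val, by rw [← ofAdd_nsmul]; simp⟩

/-! ### The semidirect product and its presentation. -/

section Rotation

variable {n d k : ℕ} {J : Set (ZMod n)} (e : J ≃ Fin k) (ρ : ZMod d →+ ZMod n)
  (hJ : ∀ j ∈ J, ∀ i, j + ρ i ∈ J)

/-- The translation of the index set `J` by `ρ i`. -/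
def rotate (i : ZMod d) (j : J) : J := ⟨j + ρ i, hJ j j.2 i⟩

lemma rotate_rotate (i i' : ZMod d) (j : J) :
    rotate ρ hJ i (rotate ρ hJ i' j) = rotate ρ hJ (i' + i) j :=
  Subtype.ext (by simp [rotate, add_assoc])

lemma rotate_zero (j : J) : rotate ρ hJ 0 j = j :=
  Subtype.ext (by simp [rotate])

/-- The action of `ℤ_d` on `ℤ^k` that permutes the coordinates by translations of the index
set. -/
def rotationAut : Multiplicative (ZMod d) →* MulAut (Multiplicative (Fin k → ℤ)) where
  toFun a := AddEquiv.toMultiplicative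
    { toFun c l := c (e (rotate ρ hJ (-a.toAdd) (e.symm l)))
      invFun c l := c (e (rotate ρ hJ a.toAdd (e.symm l)))
      left_inv c := by
        funext l
        simp [rotate_rotate, rotate_zero]
      right_inv c := by
        funext l
        simp [rotate_rotate, rotate_zero]
      map_add' c c' := rfl }
  map_one' := by
    refine MulEquiv.ext fun c => ?_
    change Multiplicative.ofAdd (fun l => c.toAdd (e (rotate ρ hJ (-0) (e.symm l)))) = c
    simp [rotate_zero]
  map_mul' a b := by
    refine MulEquiv.ext fun c => ?_
    change Multiplicative.ofAdd (fun l => c.toAdd (e (rotate ρ hJ (-(a * b).toAdd) (e.symm l)))) =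
      Multiplicative.ofAdd (fun l => c.toAdd (e (rotate ρ hJ (-b.toAdd)
        (e.symm (e (rotate ρ hJ (-a.toAdd) (e.symm l)))))))
    simp [rotate_rotate, add_comm]

lemma rotationAut_apply (a : Multiplicative (ZMod d)) (c : Multiplicative (Fin k → ℤ))
    (l : Fin k) : (rotationAut e ρ hJ a c).toAdd l =
      c.toAdd (e (rotate ρ hJ (-a.toAdd) (e.symm l))) := rfl

/-- The minus sign in the action on coordinates moves basis vectors forward; for the generator of
$\mathbb Z_d$ this is the relation $yx_j=x_{j+n/d}y$. -/
lemma rotationAut_single (a : Multiplicative (ZMod d)) (j : J) :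
    rotationAut e ρ hJ a (Multiplicative.ofAdd (Pi.single (e j) 1)) =
      Multiplicative.ofAdd (Pi.single (e (rotate ρ hJ a.toAdd j)) 1) := by
  change Multiplicative.ofAdd _ = _
  congr 1
  funext l
  obtain ⟨j', rfl⟩ := e.surjective l
  change (Pi.single (e j) (1 : ℤ) : Fin k → ℤ) (e (rotate ρ hJ (-a.toAdd) (e.symm (e j')))) = _
  simp only [Pi.single_apply, Equiv.symm_apply_apply, e.injective.eq_iff]
  congr 1
  apply propext
  constructor
  · rintro rfl
    simp [rotate_rotate, rotate_zero]
  · rintro rfl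
    simp [rotate_rotate, rotate_zero]

open SemidirectProduct in
/-- The presentation of the semidirect product. -/
theorem exists_presentedGroup_mulEquiv [NeZero d] (hρ : ρ 1 = ((n / d : ℕ) : ZMod n)) :
    ∃ Φ : PresentedGroup (relations n d J) ≃*
        Multiplicative (Fin k → ℤ) ⋊[rotationAut e ρ hJ] Multiplicative (ZMod d),
      (∀ j, Φ (PresentedGroup.of (some j)) =
        inl (Multiplicative.ofAdd (Pi.single (e j) 1))) ∧
      Φ (PresentedGroup.of none) = inr (Multiplicative.ofAdd 1) := by
  set φ := rotationAut e ρ hJ with hφ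
  set F : Option J → Multiplicative (Fin k → ℤ) ⋊[φ] Multiplicative (ZMod d) := fun o =>
    o.elim (inr (Multiplicative.ofAdd 1)) fun j => inl (Multiplicative.ofAdd (Pi.single (e j) 1))
    with hF
  have hrel : ∀ r ∈ relations n d J, FreeGroup.lift F r = 1 := by
    rintro r ((rfl | ⟨j, l, rfl⟩) | ⟨j, l, hl, rfl⟩)
    · rw [map_pow, FreeGroup.lift_apply_of]
      change (inr (Multiplicative.ofAdd 1)) ^ d = _
      rw [← map_pow, ← ofAdd_nsmul]
      simp
    · rw [map_mul, map_inv, mul_inv_eq_one]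
      simp only [map_mul, FreeGroup.lift_apply_of, hF, Option.elim]
      rw [← inl.map_mul, ← inl.map_mul, mul_comm]
    · rw [map_mul, map_inv, mul_inv_eq_one]
      simp only [map_mul, FreeGroup.lift_apply_of, hF, Option.elim]
      have h1 := rotationAut_single e ρ hJ (Multiplicative.ofAdd 1) j
      have h2 : rotate ρ hJ (Multiplicative.ofAdd (1 : ZMod d)).toAdd j = l :=
        Subtype.ext (by rw [hl, ← hρ]; rfl)
      rw [h2] at h1
      rw [← h1, inl_aut]
      simp
  set P := PresentedGroup (relations n d J)
  set xs : J → P := fun j => PresentedGroup.of (some j) with hxs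
  set y : P := PresentedGroup.of none with hy
  have hcomm : ∀ j l, xs j * xs l = xs l * xs j := fun j l => by
    have := PresentedGroup.one_of_mem (rels := relations n d J)
      (Or.inl (Or.inr ⟨j, l, rfl⟩))
    rw [map_mul, map_inv, mul_inv_eq_one, map_mul, map_mul] at this
    exact this
  have hyd : y ^ d = 1 := by
    have := PresentedGroup.one_of_mem (rels := relations n d J) (Or.inl (Or.inl rfl))
    rwa [map_pow] at this
  have hconj : ∀ j, y * xs j = xs (rotate ρ hJ 1 j) * y := fun j => by
    have := PresentedGroup.one_of_mem (rels := relations n d J)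
      (Or.inr ⟨j, rotate ρ hJ 1 j, by rw [← hρ]; rfl, rfl⟩)
    rw [map_mul, map_inv, mul_inv_eq_one, map_mul, map_mul] at this
    exact this
  obtain ⟨f₁, hf₁⟩ := exists_monoidHom_of_commute (fun l => xs (e.symm l))
    fun i j => hcomm _ _
  obtain ⟨f₂, hf₂⟩ := exists_monoidHom_zmod y hyd
  -- Compatibility of `f₁` and `f₂` need only be checked for the generator of $\mathbb Z_d$ and on
  -- basis vectors, where it is the conjugation relation; powers follow by induction.
  have hcompat1 : ∀ c, f₁ (φ (Multiplicative.ofAdd 1) c) = y * f₁ c * y⁻¹ := by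
    intro c
    have : f₁.comp (φ (Multiplicative.ofAdd 1)).toMonoidHom =
        (MulAut.conj y).toMonoidHom.comp f₁ := by
      refine monoidHom_ext_of_single fun l => ?_
      obtain ⟨j, rfl⟩ := e.surjective l
      have h1 := rotationAut_single e ρ hJ (Multiplicative.ofAdd 1) j
      rw [MonoidHom.comp_apply, MonoidHom.comp_apply, MulEquiv.coe_toMonoidHom, hφ, h1, hf₁, hf₁]
      simp only [Equiv.symm_apply_apply, MulEquiv.coe_toMonoidHom, MulAut.conj_apply]
      rw [hconj, mul_inv_cancel_right]
      rfl
    exact DFunLike.congr_fun this c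
  have hcompat : ∀ a, f₁.comp (φ a).toMonoidHom = (MulAut.conj (f₂ a)).toMonoidHom.comp f₁ := by
    intro a
    obtain ⟨m, rfl⟩ := exists_eq_ofAdd_one_pow a
    refine MonoidHom.ext fun c => ?_
    simp only [MonoidHom.comp_apply, MulEquiv.coe_toMonoidHom, map_pow, hf₂]
    induction m with
    | zero => simp
    | succ m ih =>
      rw [pow_succ', MulAut.mul_apply, hcompat1, ih, pow_succ', MulAut.mul_apply,
        MulAut.conj_apply]
  set G := SemidirectProduct.lift f₁ f₂ hcompat with hG
  -- Both composites fix the generators.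
  refine ⟨MonoidHom.toMulEquiv (PresentedGroup.toGroup hrel) G ?_ ?_, fun j => ?_, ?_⟩
  · refine PresentedGroup.ext fun o => ?_
    rw [MonoidHom.comp_apply, PresentedGroup.toGroup.of]
    rcases o with _ | j
    · simp only [hF, Option.elim, hG, lift_inr, hf₂]
      rfl
    · simp only [hF, Option.elim, hG, lift_inl, hf₁, Equiv.symm_apply_apply]
      rfl
  · refine SemidirectProduct.hom_ext (monoidHom_ext_of_single fun l => ?_) ?_
    · simp only [MonoidHom.comp_apply, hG, lift_inl, hf₁, hxs, PresentedGroup.toGroup.of, hF,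
        Option.elim, Equiv.apply_symm_apply, MonoidHom.id_apply]
    · refine MonoidHom.ext fun a => ?_
      obtain ⟨m, rfl⟩ := exists_eq_ofAdd_one_pow a
      simp only [MonoidHom.comp_apply, hG, lift_inr, map_pow, hf₂, hy, PresentedGroup.toGroup.of,
        hF, Option.elim, MonoidHom.id_apply]
  · exact PresentedGroup.toGroup.of hrel
  · exact PresentedGroup.toGroup.of hrel

end Rotation

/-! ### Type-preserving rotations and their effect on the arcs. -/

/-- A subgroup `R` of `ℤ_n` of order `d` is generated by `n / d`. -/
lemma exists_addMonoidHom_range_eq {n : ℕ} (hn : 0 < n) (R : AddSubgroup (ZMod n)) :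
    Nat.card R ∣ n ∧ ∃ ρ : ZMod (Nat.card R) →+ ZMod n, Function.Injective ρ ∧
      ρ.range = R ∧ ρ 1 = ((n / Nat.card R : ℕ) : ZMod n) := by
  have : NeZero n := ⟨hn.ne'⟩
  set d := Nat.card R with hd
  have hdn : d ∣ n := by
    have := AddSubgroup.card_addSubgroup_dvd_card R
    rwa [Nat.card_zmod] at this
  refine ⟨hdn, ?_⟩
  obtain ⟨q, hq⟩ := hdn
  have hd0 : 0 < d := Nat.pos_of_mul_pos_right (hq ▸ hn)
  have hq0 : 0 < q := Nat.pos_of_mul_pos_left (hq ▸ hn)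
  have : NeZero d := ⟨hd0.ne'⟩
  have hnd : n / d = q := by rw [hq, Nat.mul_div_cancel_left _ hd0]
  have hf : zmultiplesHom (ZMod n) (q : ZMod n) (d : ℤ) = 0 := by
    rw [zmultiplesHom_apply, natCast_zsmul, nsmul_eq_mul, ← Nat.cast_mul, ← hq,
      ZMod.natCast_self]
  set ρ : ZMod d →+ ZMod n := ZMod.lift d ⟨zmultiplesHom (ZMod n) (q : ZMod n), hf⟩ with hρ
  have hρm : ∀ m : ℕ, ρ (m : ZMod d) = ((m * q : ℕ) : ZMod n) := fun m => by
    have := ZMod.lift_coe d ⟨zmultiplesHom (ZMod n) (q : ZMod n), hf⟩ (m : ℤ)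
    rw [Int.cast_natCast] at this
    rw [hρ, this]
    simp
  have hinj : Function.Injective ρ := by
    rw [injective_iff_map_eq_zero]
    intro i hi
    rw [← ZMod.natCast_zmod_val i, hρm, ZMod.natCast_eq_zero_iff, hq] at hi
    have := Nat.dvd_of_mul_dvd_mul_right hq0 hi
    rw [← ZMod.natCast_zmod_val i]
    exact (ZMod.natCast_eq_zero_iff _ _).2 this
  refine ⟨ρ, hinj, ?_, ?_⟩
  -- The order of `R` kills each of its elements, so these are multiples of `q = n / d`; the two
  -- subgroups then agree by cardinality.
  · refine (AddSubgroup.eq_of_le_of_card_ge ?_ ?_).symm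
    · intro r hr
      have h1 : d • (⟨r, hr⟩ : R) = 0 := card_nsmul_eq_zero'
      have h2 : d • r = 0 := congrArg Subtype.val h1
      rw [nsmul_eq_mul, ← ZMod.natCast_zmod_val r, ← Nat.cast_mul, ZMod.natCast_eq_zero_iff] at h2
      obtain ⟨m, hm⟩ := Nat.dvd_of_mul_dvd_mul_left hd0 (hq.symm.dvd.trans h2)
      refine ⟨(m : ZMod d), ?_⟩
      rw [hρm, mul_comm, ← hm, ZMod.natCast_zmod_val]
    · rw [← hd]
      have := Nat.card_congr (Equiv.ofInjective ρ hinj)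
      rw [Nat.card_zmod] at this
      exact this.ge
  · have := hρm 1
    rw [hnd]
    simpa using this

section

variable {B : ℂ → ℂ} {n : ℕ} [NeZero n] {θ : ℤ → ℝ} {H : ℝ → ℝ}
  (hθ : IsCyclicEnumeration (singularSet B) n θ) (hH : IsPeriodicArg B θ H)

include hθ hH

lemma IsPeriodicArg.image_arc (j : ℤ) :
    H '' Ioo (arcStart θ (j : ZMod n)) (arcEnd θ (j : ZMod n)) =
      H '' Ioo (θ j) (θ (j + 1)) := by
  rw [arcStart, arcEnd]
  exact hH.image_congr hθ (by rw [Int.cast_natCast, ZMod.natCast_zmod_val])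

omit [NeZero n] hθ in
lemma IsPeriodicArg.isArgLift_arc (a : ZMod n) :
    IsArgLift B H (arcStart θ a) (arcEnd θ a) := hH.isArgLift _

omit [NeZero n] hθ in
-- Once written as an equality of ranges, having the same type is visibly an equivalence relation,
-- which makes the type-preserving rotations a group.
lemma IsPeriodicArg.sameType_iff (a b : ZMod n) :
    SameType B (arcStart θ a) (arcEnd θ a) (arcStart θ b) (arcEnd θ b) ↔
      H '' Ioo (arcStart θ a) (arcEnd θ a) = H '' Ioo (arcStart θ b) (arcEnd θ b) :=
  ⟨(hH.isArgLift_arc a).image_eq_of_sameType (hH.isArgLift_arc b) (hH.isNormalised _)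
    (hH.isNormalised _), (hH.isArgLift_arc a).sameType_of_image_eq (hH.isArgLift_arc b)⟩

lemma mem_typePreservingRotations_iff (s : ℤ) :
    (s : ZMod n) ∈ typePreservingRotations B n θ ↔
      ∀ j, H '' Ioo (θ (j + s)) (θ (j + s + 1)) = H '' Ioo (θ j) (θ (j + 1)) := by
  simp only [typePreservingRotations, mem_ofPred_eq, hH.sameType_iff]
  constructor
  · intro h j
    have := h j
    rw [← Int.cast_add, hH.image_arc hθ, hH.image_arc hθ] at this
    exact this.symm
  · intro h a
    obtain ⟨j, rfl⟩ := ZMod.intCast_surjective a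
    rw [← Int.cast_add, hH.image_arc hθ, hH.image_arc hθ, h]

lemma mem_type2Indices_iff (j : ℤ) :
    (j : ZMod n) ∈ type2Indices B n θ ↔ H '' Ioo (θ j) (θ (j + 1)) = univ := by
  rw [← hH.image_arc hθ (n := n)]
  exact (hH.isArgLift_arc _).isType2_iff_image_eq_univ

/-- The rotations that preserve the types of the arcs form a subgroup. -/
lemma exists_addSubgroup_typePreservingRotations :
    ∃ R : AddSubgroup (ZMod n), (R : Set (ZMod n)) = typePreservingRotations B n θ := by
  refine ⟨⟨⟨⟨typePreservingRotations B n θ, ?_⟩, ?_⟩, ?_⟩, rfl⟩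
  · intro a b ha hb
    obtain ⟨i, rfl⟩ := ZMod.intCast_surjective a
    obtain ⟨j, rfl⟩ := ZMod.intCast_surjective b
    rw [← Int.cast_add, mem_typePreservingRotations_iff hθ hH]
    rw [mem_typePreservingRotations_iff hθ hH] at ha hb
    intro l
    rw [← add_assoc, hb, ha]
  · rw [← Int.cast_zero, mem_typePreservingRotations_iff hθ hH]
    simp
  · intro a ha
    obtain ⟨i, rfl⟩ := ZMod.intCast_surjective a
    rw [← Int.cast_neg, mem_typePreservingRotations_iff hθ hH]
    rw [mem_typePreservingRotations_iff hθ hH] at ha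
    intro l
    have := ha (l + -i)
    rw [neg_add_cancel_right] at this
    exact this.symm

lemma isAdmissible_iff (s : ℤ) (c : ZMod n → ℤ) :
    IsAdmissible θ H s c ↔ (s : ZMod n) ∈ typePreservingRotations B n θ ∧
      ∀ a, c a ≠ 0 → a ∈ type2Indices B n θ := by
  constructor
  · rintro ⟨h1, h2⟩
    refine ⟨(mem_typePreservingRotations_iff hθ hH s).2 h1, fun a ha => ?_⟩
    obtain ⟨j, rfl⟩ := ZMod.intCast_surjective a
    exact (mem_type2Indices_iff hθ hH j).2 (h2 j ha)
  · rintro ⟨h1, h2⟩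
    exact ⟨(mem_typePreservingRotations_iff hθ hH s).1 h1,
      fun j hj => (mem_type2Indices_iff hθ hH j).1 (h2 _ hj)⟩

lemma add_mem_type2Indices {a r : ZMod n} (ha : a ∈ type2Indices B n θ)
    (hr : r ∈ typePreservingRotations B n θ) : a + r ∈ type2Indices B n θ := by
  obtain ⟨j, rfl⟩ := ZMod.intCast_surjective a
  obtain ⟨s, rfl⟩ := ZMod.intCast_surjective r
  rw [← Int.cast_add, mem_type2Indices_iff hθ hH, (mem_typePreservingRotations_iff hθ hH s).1 hr]
  exact (mem_type2Indices_iff hθ hH j).1 ha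

omit hH in
lemma exp_mem_arc_iff {t : ℝ} {j : ℤ} (ht : t ∈ Ioo (θ j) (θ (j + 1))) (a : ZMod n) :
    Circle.exp t ∈ arc θ a ↔ (j : ZMod n) = a := by
  have hval : (((a.val : ℕ) : ℤ) : ZMod n) = a := by
    rw [Int.cast_natCast, ZMod.natCast_zmod_val]
  constructor
  · rintro ⟨u, hu, hut⟩
    obtain ⟨m, hm⟩ := Circle.exp_eq_exp.1 hut
    rw [arcStart, arcEnd] at hu
    have h1 := hθ.add_mem_Ioo_iff (m := m).2 ht
    rw [← hm] at h1
    have h2 := hθ.eq_of_mem_Ico (Ioo_subset_Ico_self h1) (Ioo_subset_Ico_self hu)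
    rw [← hval, ← h2]
    simp
  · intro hj
    obtain ⟨m, hm⟩ := (ZMod.intCast_eq_intCast_iff_dvd_sub j a.val n).1 (hj.trans hval.symm)
    have h1 := hθ.add_mem_Ioo_iff (m := m).2 ht
    rw [show j + n * m = (a.val : ℤ) by linarith] at h1
    exact ⟨_, h1, Circle.exp_eq_exp.2 ⟨m, rfl⟩⟩

lemma IsInducedBy.image_arc {s : ℤ} {c : ZMod n → ℤ} {x : Circle → Circle}
    (ha : IsAdmissible θ H s c) (h : IsInducedBy θ H s c x) (a : ZMod n) :
    x '' arc θ a = arc θ (a + (s : ZMod n)) := by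
  obtain ⟨X, hX, hx⟩ := h
  obtain ⟨Y, hY, hXY, -⟩ := hX.exists_inverse hθ hH ha
  have hval : (((a.val : ℕ) : ℤ) : ZMod n) = a := by
    rw [Int.cast_natCast, ZMod.natCast_zmod_val]
  ext p
  constructor
  · rintro ⟨_, ⟨t, ht, rfl⟩, rfl⟩
    rw [hx, exp_mem_arc_iff hθ (hX.mem_Ioo ht)]
    rw [Int.cast_add, hval]
  · intro hp
    obtain ⟨t, ht, rfl⟩ := hp
    rw [arcStart, arcEnd] at ht
    refine ⟨Circle.exp (Y t), (exp_mem_arc_iff hθ (hY.mem_Ioo ht) _).2 ?_, ?_⟩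
    · rw [Int.cast_add, Int.cast_neg, Int.cast_natCast, ZMod.natCast_zmod_val,
        add_neg_cancel_right]
    · rw [hx]
      exact congrArg _ (congrFun hXY t)

omit hθ in
-- The map raises `H` by exactly $2\pi$, and strictly in between `H` lies strictly between these two
-- values, where the exponential does not return to its initial value.
lemma IsInducedBy.shiftsElements {c : ZMod n → ℤ} {x : Circle → Circle}
    (h : IsInducedBy θ H 0 c x) {a : ZMod n} (hc : c a = 1) :
    ShiftsElements B x (arcStart θ a) (arcEnd θ a) := by
  obtain ⟨X, hX, hx⟩ := h
  have hL := hH.isArgLift_arc a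
  have hpi := Real.two_pi_pos
  intro t ht
  have h1 := hX.mem_Ioo ht
  have h2 := hX.arg_apply ht
  rw [add_zero] at h1 h2
  rw [Int.cast_natCast, ZMod.natCast_zmod_val, hc, Int.cast_one, one_mul] at h2
  have hlt : t < X t := by
    rw [← hL.strictMonoOn.lt_iff_lt ht h1, h2]
    linarith
  refine ⟨X t, ⟨hlt, h1.2⟩, hx t, ?_, fun u hu heq => ?_⟩
  · have h3 : Circle.exp (H t + 2 * Real.pi) = Circle.exp (H t) :=
      Circle.exp_eq_exp.2 ⟨1, by simp⟩
    rw [hL.eq_exp _ h1, hL.eq_exp _ ht, h2, h3]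
  · have hu' : u ∈ Ioo (arcStart θ a) (arcEnd θ a) := ⟨ht.1.trans hu.1, hu.2.trans h1.2⟩
    rw [hL.eq_exp _ hu', hL.eq_exp _ ht] at heq
    obtain ⟨m, hm⟩ := Circle.exp_eq_exp.1 (Circle.coe_injective heq)
    have h3 := hL.strictMonoOn ht hu' hu.1
    have h4 := hL.strictMonoOn hu' h1 hu.2
    rw [h2] at h4
    have h5 : (0 : ℝ) < m := by
      by_contra hcon
      nlinarith [not_lt.1 hcon]
    have h6 : (m : ℝ) < 1 := by
      by_contra hcon
      nlinarith [not_lt.1 hcon]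
    have h7 : 0 < m := by exact_mod_cast h5
    have h8 : m < 1 := by exact_mod_cast h6
    omega

lemma IsInducedBy.apply_eq_self {c : ZMod n → ℤ} {x : Circle → Circle}
    (h : IsInducedBy θ H 0 c x) {a : ZMod n} (hc : ∀ b, b ≠ a → c b = 0) {p : Circle}
    (hp : p ∉ arc θ a) : x p = p := by
  obtain ⟨X, hX, hx⟩ := h
  obtain ⟨t, rfl⟩ := circleExp_surjective p
  simp only [hx]
  obtain ⟨j, rfl | ht⟩ := hθ.eq_or_mem_Ioo t
  · rw [hX.apply_endpoint, add_zero]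
  · have h1 := hX.mem_Ioo ht
    have h2 := hX.arg_apply ht
    rw [add_zero] at h1 h2
    rw [hc _ fun hja => hp ((exp_mem_arc_iff hθ ht a).2 hja), Int.cast_zero, zero_mul,
      add_zero] at h2
    rw [(hH.isArgLift j).strictMonoOn.injOn h1 ht h2]

end

/-! ### The invariants as a semidirect product. -/

/-- The extension by zero of a function on an enumerated set of indices. -/
def extendZero {n k : ℕ} {J : Set (ZMod n)} (e : J ≃ Fin k) (c : Fin k → ℤ) (a : ZMod n) : ℤ :=
  open Classical in if h : a ∈ J then c (e ⟨a, h⟩) else 0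

lemma extendZero_coe {n k : ℕ} {J : Set (ZMod n)} (e : J ≃ Fin k) (c : Fin k → ℤ) (j : J) :
    extendZero e c j = c (e j) := by
  simp [extendZero]

lemma extendZero_of_notMem {n k : ℕ} {J : Set (ZMod n)} (e : J ≃ Fin k) (c : Fin k → ℤ)
    {a : ZMod n} (ha : a ∉ J) : extendZero e c a = 0 := by
  simp [extendZero, ha]

section

variable {B : ℂ → ℂ} {n d k : ℕ} [NeZero n] {θ : ℤ → ℝ} {H : ℝ → ℝ}
  (hθ : IsCyclicEnumeration (singularSet B) n θ) (hH : IsPeriodicArg B θ H)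
  (e : type2Indices B n θ ≃ Fin k) (ρ : ZMod d →+ ZMod n) (hρi : Function.Injective ρ)
  (hρ : ∀ r, r ∈ typePreservingRotations B n θ ↔ r ∈ ρ.range)
  (hJ : ∀ j ∈ type2Indices B n θ, ∀ i, j + ρ i ∈ type2Indices B n θ)

include hθ hH hρi hρ

/-- The invariants are parametrised by the semidirect product. -/
lemma exists_mulEquiv_invariants :
    ∃ ψ : Multiplicative (Fin k → ℤ) ⋊[rotationAut e ρ hJ] Multiplicative (ZMod d) ≃*
        invariants B,
      ∀ g, IsInducedBy θ H ((ρ g.right.toAdd).val : ℤ) (extendZero e g.left.toAdd) (ψ g).1 := by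
  have hadm : ∀ g : Multiplicative (Fin k → ℤ) ⋊[rotationAut e ρ hJ] Multiplicative (ZMod d),
      IsAdmissible θ H ((ρ g.right.toAdd).val : ℤ) (extendZero e g.left.toAdd) := by
    intro g
    rw [isAdmissible_iff hθ hH, Int.cast_natCast, ZMod.natCast_zmod_val, hρ]
    refine ⟨⟨_, rfl⟩, fun a ha => ?_⟩
    by_contra hcon
    exact ha (extendZero_of_notMem e _ hcon)
  have hex := fun g => (hadm g).exists_isInducedBy hθ hH
  choose f hf using hex
  -- Extended by zero, a rotated family is the translated one, because the type $2$ indices are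
  -- stable under `ρ`. This matches composition of arc maps with the semidirect multiplication.
  have hext : ∀ (i : Multiplicative (ZMod d)) (c : Multiplicative (Fin k → ℤ)) (a : ZMod n),
      extendZero e (rotationAut e ρ hJ i c).toAdd a = extendZero e c.toAdd (a - ρ i.toAdd) := by
    intro i c a
    by_cases ha : a ∈ type2Indices B n θ
    · have h1 := extendZero_coe e (rotationAut e ρ hJ i c).toAdd ⟨a, ha⟩
      have h2 := extendZero_coe e c.toAdd (rotate ρ hJ (-i.toAdd) ⟨a, ha⟩)
      rw [rotationAut_apply, Equiv.symm_apply_apply] at h1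
      have h3 : ((rotate ρ hJ (-i.toAdd) ⟨a, ha⟩ : type2Indices B n θ) : ZMod n) =
          a - ρ i.toAdd := by
        simp [rotate, sub_eq_add_neg]
      rw [h3] at h2
      exact h1.trans h2.symm
    · rw [extendZero_of_notMem e _ ha, extendZero_of_notMem]
      intro hcon
      exact ha (by simpa using hJ _ hcon i.toAdd)
  have hone : f 1 = id := by
    refine IsInducedBy.eq hθ hH (hf 1) ⟨id, ?_, fun t => rfl⟩
    convert isArcMap_id using 1
    · simp
    · funext a
      simp [extendZero]
  have hmul : ∀ g g', f (g * g') = f g ∘ f g' := by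
    intro g g'
    refine IsInducedBy.eq hθ hH (hf (g * g')) ?_
    have h1 := ((hf g).comp (hf g')).congr hθ hH
      (s' := ((ρ (g * g').right.toAdd).val : ℤ)) (by
        push_cast
        simp only [ZMod.natCast_zmod_val, SemidirectProduct.mul_right, toAdd_mul, map_add])
    convert h1 using 1
    funext a
    simp only [SemidirectProduct.mul_left, toAdd_mul, Int.cast_natCast, ZMod.natCast_zmod_val]
    rw [← hext]
    by_cases ha : a ∈ type2Indices B n θ
    · simp only [extendZero, dif_pos ha, Pi.add_apply]
    · simp only [extendZero, dif_neg ha, add_zero]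
  let ψ : Multiplicative (Fin k → ℤ) ⋊[rotationAut e ρ hJ] Multiplicative (ZMod d) →*
      invariants B :=
    { toFun g := ⟨f g, (hf g).mem_invariants hθ hH (hadm g)⟩
      map_one' := Subtype.ext hone
      map_mul' g g' := Subtype.ext (hmul g g') }
  have hbij : Function.Bijective ψ := by
    constructor
    · intro g g' hgg
      have h1 := hf g
      have h2 := hf g'
      have hfg : f g = f g' := congrArg Subtype.val hgg
      rw [← hfg] at h2
      obtain ⟨h3, h4⟩ := h1.injective hθ hH (NeZero.pos n) h2
      simp only [Int.cast_natCast, ZMod.natCast_zmod_val] at h3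
      refine SemidirectProduct.ext ?_ (Multiplicative.toAdd.injective (hρi h3))
      refine Multiplicative.toAdd.injective (funext fun l => ?_)
      have := congrFun h4 (e.symm l : ZMod n)
      rwa [extendZero_coe, extendZero_coe, Equiv.apply_symm_apply] at this
    · rintro ⟨x, hx⟩
      obtain ⟨s, c, ha, hxi⟩ := exists_isInducedBy_of_mem_invariants hθ hH hx
      obtain ⟨hs, hc⟩ := (isAdmissible_iff hθ hH s c).1 ha
      obtain ⟨i, hi⟩ := (hρ _).1 hs
      refine ⟨⟨Multiplicative.ofAdd fun l => c (e.symm l), Multiplicative.ofAdd i⟩,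
        Subtype.ext ?_⟩
      refine IsInducedBy.eq hθ hH (hf _) ?_
      have h1 := hxi.congr hθ hH (s' := ((ρ i).val : ℤ)) (by
        rw [Int.cast_natCast, ZMod.natCast_zmod_val, ← hi])
      -- Admissibility makes `c` vanish off the type $2$ indices, so nothing is lost by restricting
      -- it to them.
      have hcc : extendZero e (fun l => c (e.symm l : ZMod n)) = c := by
        funext a
        by_cases haJ : a ∈ type2Indices B n θ
        · exact (extendZero_coe e _ ⟨a, haJ⟩).trans (by simp)
        · rw [extendZero_of_notMem e _ haJ]
          by_contra hcon
          exact haJ (hc a (Ne.symm hcon))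
      rw [← hcc] at h1
      exact h1
  exact ⟨MulEquiv.ofBijective ψ hbij, hf⟩

end

end BlaschkeInvariants

end

open BlaschkeInvariants

/-! ### The main theorem. -/

theorem mainTheorem1 (B : ℂ → ℂ) (hB : IsBlaschkeProduct B)
    (n : ℕ) (hn : 0 < n) (hσ : (singularSet B).encard = n)
    (θ : ℤ → ℝ) (hθ : IsCyclicEnumeration (singularSet B) n θ)
    (k d : ℕ) (hk : k = (type2Indices B n θ).ncard)
    (hd : d = (typePreservingRotations B n θ).ncard) :
    k ≤ n ∧ 1 ≤ d ∧ d ≤ n ∧ d ∣ n ∧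
    ∃ (x : type2Indices B n θ → invariants B) (y : invariants B),
      (∀ j, ShiftsElements B (x j).1 (arcStart θ j.1) (arcEnd θ j.1) ∧
        ∀ p, p ∉ arc θ j.1 → (x j).1 p = p) ∧
      (∀ j : ZMod n, (y.1 : Circle → Circle) '' arc θ j = arc θ (j + ((n / d : ℕ) : ZMod n))) ∧
      (∃ Φ : PresentedGroup (relations n d (type2Indices B n θ)) ≃* invariants B,
        (∀ j, Φ (PresentedGroup.of (some j)) = x j) ∧ Φ (PresentedGroup.of none) = y) ∧
      (∃ (φ : Multiplicative (ZMod d) →* MulAut (Multiplicative (Fin k → ℤ)))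
          (Ψ : invariants B ≃* Multiplicative (Fin k → ℤ) ⋊[φ] Multiplicative (ZMod d))
          (e : type2Indices B n θ ≃ Fin k),
        (∀ j, Ψ (x j) = SemidirectProduct.inl (Multiplicative.ofAdd (Pi.single (e j) 1))) ∧
        Ψ y = SemidirectProduct.inr (Multiplicative.ofAdd 1)) := by
  have : NeZero n := ⟨hn.ne'⟩
  obtain ⟨H, hH⟩ := hB.exists_isPeriodicArg hn hθ
  obtain ⟨R, hR⟩ := exists_addSubgroup_typePreservingRotations hθ hH
  have hRd : Nat.card R = d := by
    rw [hd, ← hR]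
    rfl
  obtain ⟨hdn, ρ, hρi, hρR, hρ1⟩ := exists_addMonoidHom_range_eq hn R
  rw [hRd] at hdn
  subst hRd
  have : NeZero (Nat.card R) := ⟨Nat.card_pos.ne'⟩
  have hρ : ∀ r, r ∈ typePreservingRotations B n θ ↔ r ∈ ρ.range := fun r => by
    rw [hρR, ← hR]
    rfl
  have hJ : ∀ j ∈ type2Indices B n θ, ∀ i, j + ρ i ∈ type2Indices B n θ := fun j hj i =>
    add_mem_type2Indices hθ hH hj ((hρ _).2 ⟨i, rfl⟩)
  have e : type2Indices B n θ ≃ Fin k := Finite.equivFinOfCardEq (hk ▸ rfl)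
  obtain ⟨ψ, hψ⟩ := exists_mulEquiv_invariants hθ hH e ρ hρi hρ hJ
  obtain ⟨Φ, hΦ, hΦ'⟩ := exists_presentedGroup_mulEquiv e ρ hJ hρ1
  -- The element $x_j$ is the pair with no rotation and a single unit shift on the arc $I_j$; $y$ is
  -- the rotation by `ρ 1 = n / d` without shifts.
  refine ⟨?_, Nat.card_pos, Nat.le_of_dvd hn hdn, hdn,
    fun j => ψ (SemidirectProduct.inl (Multiplicative.ofAdd (Pi.single (e j) 1))),
    ψ (SemidirectProduct.inr (Multiplicative.ofAdd 1)), fun j => ?_, fun j => ?_,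
    ⟨Φ.trans ψ, fun j => by simp [hΦ], by simp [hΦ']⟩,
    ⟨rotationAut e ρ hJ, ψ.symm, e, fun j => by simp, by simp⟩⟩
  · rw [hk]
    have := Set.ncard_le_card (type2Indices B n θ)
    rwa [Nat.card_zmod] at this
  · have h1 := hψ (SemidirectProduct.inl (Multiplicative.ofAdd (Pi.single (e j) 1)))
    simp only [SemidirectProduct.right_inl, SemidirectProduct.left_inl, toAdd_one, map_zero,
      ZMod.val_zero, Nat.cast_zero, toAdd_ofAdd] at h1
    refine ⟨h1.shiftsElements hH ?_, fun p hp => h1.apply_eq_self hθ hH (fun b hb => ?_) hp⟩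
    · rw [extendZero_coe, Pi.single_eq_same]
    · by_cases hbJ : b ∈ type2Indices B n θ
      · refine (extendZero_coe e _ ⟨b, hbJ⟩).trans (Pi.single_eq_of_ne ?_ _)
        exact fun h => hb (congrArg Subtype.val (e.injective h))
      · exact extendZero_of_notMem e _ hbJ
  · have h1 := hψ (SemidirectProduct.inr (Multiplicative.ofAdd 1))
    simp only [SemidirectProduct.right_inr, SemidirectProduct.left_inr, toAdd_ofAdd, hρ1] at h1
    have ha : IsAdmissible θ H
        ((((n / Nat.card R : ℕ) : ZMod n).val : ℕ) : ℤ)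
        (extendZero e (Multiplicative.toAdd (1 : Multiplicative (Fin k → ℤ)))) := by
      rw [isAdmissible_iff hθ hH, Int.cast_natCast, ZMod.natCast_zmod_val, ← hρ1, hρ]
      refine ⟨⟨_, rfl⟩, fun a ha => ?_⟩
      by_contra hcon
      exact ha (extendZero_of_notMem e _ hcon)
    have h2 := h1.image_arc hθ hH ha j
    rwa [Int.cast_natCast, ZMod.natCast_zmod_val] at h2
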